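/- Let $X$ be a complex manifold with $\dim_{\mathbb C}X=2$ and let $\Omega\Subset X$ be a relatively compact domain whose boundary $M=\partial\Omega$ is a $\mathcal C^3$-smooth Levi-flat real hypersurface (the Levi form of a local defining function vanishes on $TM\cap JTM$, where $J$ is the complex structure of $X$). Let $\delta:\overline\Omega\to\mathbb R$ be a $\mathcal C^3$-smooth boundary distance function of $\Omega$, that is, $\Omega=\{\delta>0\}$ and $d\delta\neq0$ on $M$. Assume that the Diederich--Fornaess exponent of $\delta$ in the weak sense, $$\eta_\delta=\sup\{\eta\in(0,1): -\delta^{\eta}\text{ is strictly plurisubharmonic on }\Omega\setminus K\text{ for some compact }K\subset\Omega\},$$ is positive ($\sup\emptyset=0$). For $p\in M$ let $$\eta_\delta(p)=\sup\{\eta\in(0,1): -\delta^{\eta}\text{ is strictly plurisubharmonic on }U\cap\Omega\text{ for some neighbourhood }U\text{ of }p\}$$ (again $\sup\emptyset=0$) be the local Diederich--Fornaess exponent. In a foliated chart of the Levi foliation of $M$ with parametrization $\varphi(z,t)$, $(z,t)\in V\subset\mathbb C\times\mathbb R$ open, of class $\mathcal C^3$ and holomorphic in $z$, put $$h_\delta=\left|\left(J\varphi_*\tfrac{\partial}{\partial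 t}\right)\delta\right|,\qquad i\Theta_{h_\delta}=-\frac{\partial^2\log h_\delta}{\partial z\,\partial\bar z}\,i\,dz\wedge d\bar z,\qquad iA_{h_\delta}=\frac{\partial\log h_\delta}{\partial z}\frac{\partial\log h_\delta}{\partial\bar z}\,i\,dz\wedge d\bar z .$$ Then, for every $p\in M$ and every foliated chart around $p$, $i\Theta_{h_\delta}(p)\ge0$, and if $i\Theta_{h_\delta}(p)\neq0$, then $$\eta_\delta(p)=\left(1+\frac{iA_{h_\delta}(p)}{i\Theta_{h_\delta}(p)}\right)^{-1}.$$ If moreover there are a hermitian metric $\omega$ of $X$ and a compact set $K\subset\Omega$ with $i\partial\overline\partial(-\log\delta)\ge\omega$ on $\Omega\setminus K$, then $i\Theta_{h_\delta}(p)>0$, and hence the formula holds, at every $p\in M$. -/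

import Mathlib

open scoped Manifold ContDiff ComplexOrder

noncomputable section

namespace LeviFlat

variable {E : Type*} [NormedAddCommGroup E] [NormedSpace ℂ E]
  {X : Type*} [TopologicalSpace X] [ChartedSpace E X]

/-- A complex manifold is a real manifold, with the same charts. -/
theorem isManifold_real [IsManifold 𝓘(ℂ, E) ω X] : IsManifold 𝓘(ℝ, E) 1 X := by
  have h1 : IsManifold 𝓘(ℂ, E) 1 X := IsManifold.of_le (n := ω) le_top
  refine isManifold_of_contDiffOn 𝓘(ℝ, E) 1 X ?_
  intro e e' he he'
  have h : ContDiffOn ℂ 1 (𝓘(ℂ, E) ∘ (e.symm ≫ₕ e') ∘ 𝓘(ℂ, E).symm)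
      (𝓘(ℂ, E).symm ⁻¹' (e.symm ≫ₕ e').source ∩ Set.range 𝓘(ℂ, E)) :=
    (HasGroupoid.compatible (G := contDiffGroupoid 1 𝓘(ℂ, E)) he he').1
  exact ContDiffOn.restrict_scalars ℝ h

/-- The complex Hessian (Levi form) `∑ f_{j k̄} v_j v̄_k` of a real function `f` of class `C²` on a
complex manifold, at the point `x` and on the tangent vector `v ∈ T_x X = E`, computed in the
preferred holomorphic chart at `x`.  It is written without coordinates as
`(D² f (v, v) + D² f (i v, i v)) / 4`. -/
def leviForm (f : X → ℝ) (x : X) (v : E) : ℝ :=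
  let D2 := fderiv ℝ (fderiv ℝ (f ∘ (chartAt E x).symm)) (chartAt E x x)
  (D2 v v + D2 (Complex.I • v) (Complex.I • v)) / 4

/-- The real differential `df_x (v)` of a real function on `X`, on `v ∈ T_x X = E`. -/
def diff (f : X → ℝ) (x : X) (v : E) : ℝ :=
  mfderiv 𝓘(ℝ, E) 𝓘(ℝ, ℝ) f x v

/-- Strict plurisubharmonicity on `S`, for a function which is of class `C²` near each point of `S`:
the complex Hessian is positive definite at every point of `S`. -/
def StrictlyPSHOn (f : X → ℝ) (S : Set X) : Prop :=
  ∀ x ∈ S, ∀ v : E, v ≠ 0 → 0 < leviForm f x v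

/-- `ρ` is a local defining function of class `C³` of `Ω` on the open set `U`. -/
structure IsLocalDefiningFunction (Ω U : Set X) (ρ : X → ℝ) : Prop where
  isOpen : IsOpen U
  contMDiffOn : ContMDiffOn 𝓘(ℝ, E) 𝓘(ℝ, ℝ) 3 ρ U
  diff_ne_zero : ∀ x ∈ U, ∃ v : E, diff ρ x v ≠ 0
  inter_eq : Ω ∩ U = {x ∈ U | 0 < ρ x}

/-- The boundary of `Ω` is a real hypersurface of class `C³` (with `Ω` locally on one side of it)
and it is Levi-flat: the Levi form of a defining function vanishes on the complex tangent space
`TM ∩ J TM` at every boundary point. -/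
def HasLeviFlatBoundary (E : Type*) [NormedAddCommGroup E] [NormedSpace ℂ E]
    {X : Type*} [TopologicalSpace X] [ChartedSpace E X] (Ω : Set X) : Prop :=
  ∀ p ∈ frontier Ω, ∃ (U : Set X) (ρ : X → ℝ),
    p ∈ U ∧ IsLocalDefiningFunction (E := E) Ω U ρ ∧
      ∀ x ∈ frontier Ω ∩ U, ∀ v : E,
        diff ρ x v = 0 → diff ρ x (Complex.I • v) = 0 → leviForm ρ x v = 0

/-- `δ` is a boundary distance function of class `C³` of `Ω`: a `C³` function on the closure of `Ω`
(that is, the restriction of a `C³` function on an open neighbourhood of the closure) which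
satisfies `Ω = {δ > 0}`, and `dδ ≠ 0` on the boundary.  The values of `δ` far from the closure of
`Ω` play no role. -/
structure IsBoundaryDistance (E : Type*) [NormedAddCommGroup E] [NormedSpace ℂ E]
    {X : Type*} [TopologicalSpace X] [ChartedSpace E X] (Ω : Set X) (δ : X → ℝ) : Prop where
  contMDiffOn : ∃ W : Set X, IsOpen W ∧ closure Ω ⊆ W ∧ ContMDiffOn 𝓘(ℝ, E) 𝓘(ℝ, ℝ) 3 δ W
  pos_iff : ∀ x ∈ closure Ω, x ∈ Ω ↔ 0 < δ x
  diff_ne_zero : ∀ p ∈ frontier Ω, ∃ v : E, diff δ p v ≠ 0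

/-- The Diederich--Fornaess exponent (in the weak sense) of `δ`: the supremum of the
`η ∈ (0, 1)` such that `-δ ^ η` is strictly plurisubharmonic on `Ω` except a compact subset.
The supremum of the empty set is `0`. -/
def dfExponent (E : Type*) [NormedAddCommGroup E] [NormedSpace ℂ E]
    {X : Type*} [TopologicalSpace X] [ChartedSpace E X] (Ω : Set X) (δ : X → ℝ) : ℝ :=
  sSup {η : ℝ | η ∈ Set.Ioo (0 : ℝ) 1 ∧
    ∃ K ⊆ Ω, IsCompact K ∧ StrictlyPSHOn (E := E) (fun x => -(δ x) ^ η) (Ω \ K)}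

/-- The local Diederich--Fornaess exponent of `δ` at the boundary point `p`: the supremum of the
`η ∈ (0, 1)` such that `-δ ^ η` is strictly plurisubharmonic on `U ∩ Ω` for some neighbourhood `U`
of `p`.  The supremum of the empty set is `0`. -/
def localDFExponent (E : Type*) [NormedAddCommGroup E] [NormedSpace ℂ E]
    {X : Type*} [TopologicalSpace X] [ChartedSpace E X] (Ω : Set X) (δ : X → ℝ) (p : X) : ℝ :=
  sSup {η : ℝ | η ∈ Set.Ioo (0 : ℝ) 1 ∧
    ∃ U : Set X, IsOpen U ∧ p ∈ U ∧ StrictlyPSHOn (E := E) (fun x => -(δ x) ^ η) (U ∩ Ω)}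

/-- A foliated chart of the Levi foliation of the real hypersurface `M` of a complex surface, given
by its parametrization `φ : ℂ × ℝ ⊃ V → M`, `(z, t) ↦ φ (z, t)`: it is of class `C³`, holomorphic
in `z`, and a diffeomorphism onto an open subset of `M`.  (Then the plaques `t = const` are complex
curves in `M`, that is, open subsets of leaves of the Levi foliation.) -/
structure IsFoliatedChart (E : Type*) [NormedAddCommGroup E] [NormedSpace ℂ E]
    {X : Type*} [TopologicalSpace X] [ChartedSpace E X]
    (M : Set X) (V : Set (ℂ × ℝ)) (φ : ℂ × ℝ → X) : Prop where
  isOpen : IsOpen V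
  contMDiffOn : ContMDiffOn 𝓘(ℝ, ℂ × ℝ) 𝓘(ℝ, E) 3 φ V
  holomorphic : ∀ t : ℝ,
    MDifferentiableOn 𝓘(ℂ, ℂ) 𝓘(ℂ, E) (fun z : ℂ => φ (z, t)) {z : ℂ | (z, t) ∈ V}
  injOn : Set.InjOn φ V
  immersion : ∀ q ∈ V, Function.Injective (mfderiv 𝓘(ℝ, ℂ × ℝ) 𝓘(ℝ, E) φ q)
  image_eq : ∃ O : Set X, IsOpen O ∧ φ '' V = O ∩ M

/-- The vector `φ_* (∂/∂t)` at the parameter `q`, an element of `T_{φ q} X = E`. -/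
def transverseVector (E : Type*) [NormedAddCommGroup E] [NormedSpace ℂ E]
    {X : Type*} [TopologicalSpace X] [ChartedSpace E X] (φ : ℂ × ℝ → X) (q : ℂ × ℝ) : E :=
  mfderiv 𝓘(ℝ, ℂ × ℝ) 𝓘(ℝ, E) φ q ((0, 1) : ℂ × ℝ)

/-- The hermitian metric `h_δ = |(J φ_* ∂/∂t) δ|` of the normal bundle induced by `δ`, in the
foliated chart `φ`. -/
def normalMetric (E : Type*) [NormedAddCommGroup E] [NormedSpace ℂ E]
    {X : Type*} [TopologicalSpace X] [ChartedSpace E X]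
    (δ : X → ℝ) (φ : ℂ × ℝ → X) (q : ℂ × ℝ) : ℝ :=
  |diff δ (φ q) (Complex.I • transverseVector E φ q)|

/-- The Wirtinger derivative `∂F/∂z` along the leaves `t = const`. -/
def leafDz (F : ℂ × ℝ → ℂ) (q : ℂ × ℝ) : ℂ :=
  (fderiv ℝ (fun z : ℂ => F (z, q.2)) q.1 1
    - Complex.I * fderiv ℝ (fun z : ℂ => F (z, q.2)) q.1 Complex.I) / 2

/-- The Wirtinger derivative `∂F/∂z̄` along the leaves `t = const`. -/
def leafDzbar (F : ℂ × ℝ → ℂ) (q : ℂ × ℝ) : ℂ :=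
  (fderiv ℝ (fun z : ℂ => F (z, q.2)) q.1 1
    + Complex.I * fderiv ℝ (fun z : ℂ => F (z, q.2)) q.1 Complex.I) / 2

/-- The coefficient of `i dz ∧ dz̄` in the Chern curvature along the leaves
`iΘ_h = - i ∂_b ∂̄_b log h` of the metric `h`. -/
def chernCurvature (h : ℂ × ℝ → ℝ) (q : ℂ × ℝ) : ℂ :=
  -leafDz (leafDzbar fun q' => (Real.log (h q') : ℂ)) q

/-- The coefficient of `i dz ∧ dz̄` in the form `iA_h = i ∂_b log h ∧ ∂̄_b log h`. -/
def formA (h : ℂ × ℝ → ℝ) (q : ℂ × ℝ) : ℂ :=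
  leafDz (fun q' => (Real.log (h q') : ℂ)) q * leafDzbar (fun q' => (Real.log (h q') : ℂ)) q

/-- There is a hermitian metric of `X` (a continuous Riemannian metric `g` invariant under the
complex structure) such that `i ∂∂̄ (-log δ)` is bounded below by it on `Ω` except a compact
subset. -/
def LogUniformlyPSH (E : Type*) [NormedAddCommGroup E] [NormedSpace ℂ E]
    {X : Type*} [TopologicalSpace X] [ChartedSpace E X] [IsManifold 𝓘(ℂ, E) ω X]
    (Ω : Set X) (δ : X → ℝ) : Prop :=
  haveI : IsManifold 𝓘(ℝ, E) 1 X := isManifold_real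
  ∃ g : Bundle.ContinuousRiemannianMetric E (fun x : X => TangentSpace 𝓘(ℝ, E) x),
    (∀ (x : X) (v w : E), g.inner x (Complex.I • v : E) (Complex.I • w : E) = g.inner x v w) ∧
    ∃ K ⊆ Ω, IsCompact K ∧ ∀ x ∈ Ω \ K, ∀ v : E,
      g.inner x v v ≤ leviForm (fun y => -Real.log (δ y)) x v

end LeviFlat

end

open Filter Topology

namespace LeviFlat

/-! ### Second derivatives and the Levi form on a vector space -/

section SecondDerivative

variable {F G H : Type*} [NormedAddCommGroup F] [NormedSpace ℝ F] [NormedAddCommGroup G]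
  [NormedSpace ℝ G] [NormedAddCommGroup H] [NormedSpace ℝ H]

/-! Where δ > 0, the Levi form of -δ^η is η δ^(η-2) times the quadratic form Q_c(v) = -δ·Levi(δ)(v)
+ c|∂δ(v)|² with c = 1 - η (`flatLevi_neg_rpow`); likewise c = 1 gives -log δ, with factor δ^(-2).
Everything reduces to the sign of Q_c near a boundary point.

Points near the boundary are written ψ(z,t) + s·iψ_t, and vectors b·T + s·a·N with T = ψ_z + s·iψ_zt
and N = ψ_t. At s = 0 the quantities δ, ∂δ(T) and Levi(δ)(T) vanish, so they have order s, and the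
normal component is scaled by s to match. Hence Q_c/s² converges to a quadratic form in (b, a)
(`tendsto_exponentForm`) whose coefficients involve only H = dδ(iψ_t), its first derivatives and its
Levi form along the leaf. The second-order coefficient is identified because (ψ, iψ_t) is
holomorphic along leaves (`flatLevi_leafConormal`).

Completing the square in a (`modelForm_eq`), c times the limit is a nonnegative term plus |b|²H²(c(Θ
+ A) - A), where Θ and A are the curvature and gradient coefficients of h = |H| (`curvature_eq`). If
c(Θ + A) > A, the limit is positive definite, and compactness of the unit sphere makes Q_c positive
nearby (`eventually_exponentForm_pos`). Conversely, positivity passes to the limit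
(`le_chartModelForm`), and the a which kills the squares gives A ≤ c(Θ + A) (`gradientForm_le`). The
threshold is η = Θ/(Θ + A) (`localDFExponent_eq`).

A single admissible η forces (1 - η)Θ ≥ ηA ≥ 0. For c = 1 the value at the optimal a is H²Θ, and a
lower bound by a hermitian metric survives in the limit (`curvatureForm_pos`). -/

theorem eventually_differentiableAt {f : F → G} {x : F} {n : ℕ} (hf : ContDiffAt ℝ n f x)
    (hn : n ≠ 0) : ∀ᶠ y in 𝓝 x, DifferentiableAt ℝ f y := by
  have h1 : (n : WithTop ℕ∞) ≠ 0 := by exact_mod_cast hn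
  filter_upwards [hf.eventually (by simp)] with y hy
  exact hy.differentiableAt h1

theorem differentiableAt_fderiv {f : F → G} {x : F} (hf : ContDiffAt ℝ 2 f x) :
    DifferentiableAt ℝ (fderiv ℝ f) x :=
  (hf.fderiv_right (m := 1) (by norm_num)).differentiableAt (by norm_num)

theorem fderiv_fderiv_symm {f : F → G} {x : F} (hf : ContDiffAt ℝ 2 f x) (v w : F) :
    fderiv ℝ (fderiv ℝ f) x v w = fderiv ℝ (fderiv ℝ f) x w v :=
  hf.isSymmSndFDerivAt (by simp) v w

/-- Derivative of `y ↦ f' (γ y) (ξ y)`. -/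
theorem hasFDerivAt_fderiv_apply {f : F → G} {γ ξ : H → F} {γ' ξ' : H →L[ℝ] F} {y : H}
    (hf : ContDiffAt ℝ 2 f (γ y)) (hγ : HasFDerivAt γ γ' y) (hξ : HasFDerivAt ξ ξ' y) :
    HasFDerivAt (fun z => fderiv ℝ f (γ z) (ξ z))
      ((fderiv ℝ f (γ y)).comp ξ' + ((fderiv ℝ (fderiv ℝ f) (γ y)).comp γ').flip (ξ y)) y :=
  ((differentiableAt_fderiv hf).hasFDerivAt.comp y hγ).clm_apply hξ

theorem fderiv_fderiv_apply_const {f : F → G} {x : F} (hf : ContDiffAt ℝ 2 f x) (v w : F) :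
    fderiv ℝ (fun y => fderiv ℝ f y w) x v = fderiv ℝ (fderiv ℝ f) x v w := by
  have := hasFDerivAt_fderiv_apply (γ := id) (ξ := fun _ => w) (y := x) hf (hasFDerivAt_id x)
    (hasFDerivAt_const w x)
  rw [HasFDerivAt.fderiv (f := fun y => fderiv ℝ f y w) this]
  simp

theorem fderiv_fderiv_comp {g : G → H} {f : F → G} {x : F} (hg : ContDiffAt ℝ 2 g (f x))
    (hf : ContDiffAt ℝ 2 f x) (v w : F) :
    fderiv ℝ (fderiv ℝ (g ∘ f)) x v w =
      fderiv ℝ (fderiv ℝ g) (f x) (fderiv ℝ f x v) (fderiv ℝ f x w)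
        + fderiv ℝ g (f x) (fderiv ℝ (fderiv ℝ f) x v w) := by
  have h1 : fderiv ℝ (g ∘ f) =ᶠ[𝓝 x] fun y => (fderiv ℝ g (f y)).comp (fderiv ℝ f y) := by
    filter_upwards [eventually_differentiableAt hf two_ne_zero,
      hf.continuousAt.eventually (eventually_differentiableAt hg two_ne_zero)] with y hy1 hy2
    exact fderiv_comp y hy2 hy1
  have hf1 : DifferentiableAt ℝ f x := hf.differentiableAt (by norm_num)
  have h2 := ((differentiableAt_fderiv hg).hasFDerivAt.comp x hf1.hasFDerivAt).clm_comp
    (differentiableAt_fderiv hf).hasFDerivAt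
  rw [h1.fderiv_eq, HasFDerivAt.fderiv (f := fun y => (fderiv ℝ g (f y)).comp (fderiv ℝ f y)) h2]
  simp [add_comm]

end SecondDerivative

section FlatLevi

variable {F : Type*} [NormedAddCommGroup F] [NormedSpace ℂ F]
variable {G : Type*} [NormedAddCommGroup G] [NormedSpace ℂ G]

/-- The Levi form of a real function on a complex vector space. -/
noncomputable def flatLevi (f : F → ℝ) (x v : F) : ℝ :=
  (fderiv ℝ (fderiv ℝ f) x v v
    + fderiv ℝ (fderiv ℝ f) x (Complex.I • v) (Complex.I • v)) / 4

/-- The square `|∂f (v)|²` of the modulus of the complex differential of a real function. -/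
noncomputable def normSqPartial (f : F → ℝ) (x v : F) : ℝ :=
  ((fderiv ℝ f x v) ^ 2 + (fderiv ℝ f x (Complex.I • v)) ^ 2) / 4

theorem flatLevi_congr {f g : F → ℝ} {x : F} (h : f =ᶠ[𝓝 x] g) (v : F) :
    flatLevi f x v = flatLevi g x v := by
  simp only [flatLevi, (h.fderiv (𝕜 := ℝ)).fderiv_eq]

theorem flatLevi_scalar_comp {f : F → ℝ} {g : ℝ → ℝ} {x : F} (hf : ContDiffAt ℝ 2 f x)
    (hg : ContDiffAt ℝ 2 g (f x)) (v : F) :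
    flatLevi (g ∘ f) x v
      = deriv g (f x) * flatLevi f x v + deriv (deriv g) (f x) * normSqPartial f x v := by
  have h0 : fderiv ℝ (deriv g) (f x) 1 = deriv (deriv g) (f x) := by simp
  have h1 : ∀ a b : ℝ, fderiv ℝ (fderiv ℝ g) (f x) a b = a * b * deriv (deriv g) (f x) := by
    intro a b
    have e1 := fderiv_fderiv_apply_const hg 1 1
    have e2 : (fun y => fderiv ℝ g y 1) = deriv g := by ext y; simp
    rw [e2, h0] at e1
    have e3 : fderiv ℝ (fderiv ℝ g) (f x) a b
        = fderiv ℝ (fderiv ℝ g) (f x) (a • (1 : ℝ)) (b • (1 : ℝ)) := by simp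
    rw [e3, map_smul, map_smul, _root_.smul_apply, e1]
    simp only [smul_eq_mul]; ring
  have h2 : ∀ a : ℝ, fderiv ℝ g (f x) a = a * deriv g (f x) := by
    intro a
    have e3 : fderiv ℝ g (f x) a = fderiv ℝ g (f x) (a • (1 : ℝ)) := by simp
    rw [e3, map_smul]; simp
  simp only [flatLevi, normSqPartial, fderiv_fderiv_comp hg hf, h1, h2]
  ring

/-- The Levi form of `-f ^ η`, up to the factor `η f ^ (η - 2)`. -/
noncomputable def exponentForm (f : F → ℝ) (c : ℝ) (x v : F) : ℝ :=
  -f x * flatLevi f x v + c * normSqPartial f x v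

/-- For η > 0 the prefactor is positive, so `exponentForm` carries the sign, and η enters it only
through c = 1 - η. -/
theorem flatLevi_neg_rpow {f : F → ℝ} {x : F} (hf : ContDiffAt ℝ 2 f x) (hx : 0 < f x)
    (η : ℝ) (v : F) :
    flatLevi (fun y => -(f y) ^ η) x v
      = η * f x ^ (η - 2) * exponentForm f (1 - η) x v := by
  have hd : ∀ s : ℝ, 0 < s → HasDerivAt (fun r : ℝ => -r ^ η) (-(η * s ^ (η - 1))) s :=
    fun s hs => (Real.hasDerivAt_rpow_const (Or.inl hs.ne')).neg
  have h1 : deriv (fun r : ℝ => -r ^ η) =ᶠ[𝓝 (f x)] fun s => -(η * s ^ (η - 1)) := by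
    filter_upwards [lt_mem_nhds hx] with s hs
    exact (hd s hs).deriv
  have h2 : HasDerivAt (fun s : ℝ => -(η * s ^ (η - 1)))
      (-(η * ((η - 1) * f x ^ (η - 1 - 1)))) (f x) :=
    ((Real.hasDerivAt_rpow_const (Or.inl hx.ne')).const_mul η).neg
  have hc : ContDiffAt ℝ 2 (fun r : ℝ => -r ^ η) (f x) :=
    (Real.contDiffAt_rpow_const_of_ne hx.ne').neg
  have := flatLevi_scalar_comp hf hc v
  rw [h1.deriv_eq, h2.deriv, (hd _ hx).deriv] at this
  rw [show (fun y => -(f y) ^ η) = (fun r : ℝ => -r ^ η) ∘ f from rfl, this, exponentForm,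
    show η - 1 = (η - 2) + 1 by ring, Real.rpow_add_one hx.ne',
    show η - 2 + 1 - 1 = η - 2 by ring]
  ring

theorem flatLevi_neg_log {f : F → ℝ} {x : F} (hf : ContDiffAt ℝ 2 f x) (hx : f x ≠ 0) (v : F) :
    flatLevi (fun y => -Real.log (f y)) x v = exponentForm f 1 x v / f x ^ 2 := by
  have h1 : deriv (fun r : ℝ => -Real.log r) = fun s => -s⁻¹ := by
    ext s; simp
  have h2 : HasDerivAt (fun s : ℝ => -s⁻¹) (f x ^ 2)⁻¹ (f x) := by
    have := (hasDerivAt_inv hx).neg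
    rw [neg_neg] at this
    exact this
  have hc : ContDiffAt ℝ 2 (fun r : ℝ => -Real.log r) (f x) :=
    (Real.contDiffAt_log.2 hx).neg
  have := flatLevi_scalar_comp hf hc v
  rw [h1, h2.deriv] at this
  rw [show (fun y => -Real.log (f y)) = (fun r : ℝ => -Real.log r) ∘ f from rfl, this,
    exponentForm]
  field_simp

theorem normSqPartial_log {f : F → ℝ} {x : F} (hf : DifferentiableAt ℝ f x) (hx : f x ≠ 0)
    (v : F) :
    normSqPartial (fun y => Real.log (f y)) x v = normSqPartial f x v / f x ^ 2 := by
  simp only [normSqPartial, fderiv.log hf hx, _root_.smul_apply, smul_eq_mul]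
  field_simp

theorem exponentForm_smul (f : F → ℝ) (c : ℝ) (x : F) (r : ℝ) (v : F) :
    exponentForm f c x (r • v) = r ^ 2 * exponentForm f c x v := by
  simp only [exponentForm, flatLevi, normSqPartial, smul_comm Complex.I r v, map_smul,
    _root_.smul_apply, smul_eq_mul]
  ring

/-- The first and second derivatives of a holomorphic map are compatible with multiplication
by `i`. -/
theorem fderiv_fderiv_I_smul {f : F → G} {x : F} (hf : ContDiffAt ℝ 2 f x)
    (hol : ∀ᶠ y in 𝓝 x, DifferentiableAt ℂ f y) (v w : F) :
    fderiv ℝ (fderiv ℝ f) x v (Complex.I • w) = Complex.I • fderiv ℝ (fderiv ℝ f) x v w := by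
  have h1 : (fun y => fderiv ℝ f y (Complex.I • w))
      =ᶠ[𝓝 x] fun y => Complex.I • fderiv ℝ f y w := by
    filter_upwards [hol] with y hy
    rw [hy.fderiv_restrictScalars ℝ]
    simp
  rw [← fderiv_fderiv_apply_const hf, h1.fderiv_eq, ← fderiv_fderiv_apply_const hf]
  have hd : DifferentiableAt ℝ (fun y => fderiv ℝ f y w) x :=
    (differentiableAt_fderiv hf).clm_apply (differentiableAt_const w)
  rw [fderiv_fun_const_smul hd]
  rfl

theorem fderiv_real_smul {f : F → G} {x : F} (hol : DifferentiableAt ℂ f x) (c : ℂ) (v : F) :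
    fderiv ℝ f x (c • v) = c • fderiv ℝ f x v := by
  rw [hol.fderiv_restrictScalars ℝ]
  simp

/-- The Levi form is invariant under holomorphic maps. -/
theorem flatLevi_comp_holomorphic {f : G → ℝ} {Ψ : F → G} {x : F} (hf : ContDiffAt ℝ 2 f (Ψ x))
    (hΨ : ContDiffAt ℝ 2 Ψ x) (hol : ∀ᶠ y in 𝓝 x, DifferentiableAt ℂ Ψ y) (v : F) :
    flatLevi (f ∘ Ψ) x v = flatLevi f (Ψ x) (fderiv ℝ Ψ x v) := by
  have h2 : fderiv ℝ (fderiv ℝ Ψ) x (Complex.I • v) (Complex.I • v)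
      = -fderiv ℝ (fderiv ℝ Ψ) x v v := by
    rw [fderiv_fderiv_I_smul hΨ hol, fderiv_fderiv_symm hΨ, fderiv_fderiv_I_smul hΨ hol,
      smul_smul, Complex.I_mul_I, neg_one_smul]
  simp only [flatLevi, fderiv_fderiv_comp hf hΨ, h2, fderiv_real_smul hol.self_of_nhds, map_neg]
  ring

end FlatLevi

/-! ### Flat foliated charts -/

section FlatChart

variable {F : Type*} [NormedAddCommGroup F] [NormedSpace ℂ F]

/-- A foliated chart `ψ` of the zero set of `D`, in a complex vector space, near the parameter
`q`. -/
structure IsFlatChart (D : F → ℝ) (ψ : ℂ × ℝ → F) (q : ℂ × ℝ) : Prop where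
  contDiffAt_fun : ContDiffAt ℝ 3 D (ψ q)
  contDiffAt_param : ContDiffAt ℝ 3 ψ q
  holomorphic : ∀ᶠ y in 𝓝 q, DifferentiableAt ℂ (fun z => ψ (z, y.2)) y.1
  vanish : ∀ᶠ y in 𝓝 q, D (ψ y) = 0
  injective : Function.Injective (fderiv ℝ ψ q)
  fderiv_ne : fderiv ℝ D (ψ q) ≠ 0

/-- The tangent vector `∂ψ/∂z` of the leaves. -/
noncomputable def leafVec (ψ : ℂ × ℝ → F) (y : ℂ × ℝ) : F := fderiv ℝ ψ y (1, 0)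

/-- The transverse vector `∂ψ/∂t`. -/
noncomputable def transVec (ψ : ℂ × ℝ → F) (y : ℂ × ℝ) : F := fderiv ℝ ψ y (0, 1)

/-- The mixed derivative `∂²ψ/∂z∂t`. -/
noncomputable def twistVec (ψ : ℂ × ℝ → F) (y : ℂ × ℝ) : F := fderiv ℝ (transVec ψ) y (1, 0)

/-- The parametrization `ψ (z, t) + i s ∂ψ/∂t (z, t)` of a neighbourhood of the hypersurface. -/
noncomputable def thicken (ψ : ℂ × ℝ → F) (y : (ℂ × ℝ) × ℝ) : F :=
  ψ y.1 + y.2 • (Complex.I • transVec ψ y.1)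

/-- The derivative with respect to `z` of `thicken`. -/
noncomputable def thickenLeaf (ψ : ℂ × ℝ → F) (y : (ℂ × ℝ) × ℝ) : F :=
  leafVec ψ y.1 + y.2 • (Complex.I • twistVec ψ y.1)

/-- The transverse derivative `D' (i ∂ψ/∂t)`. -/
noncomputable def conormal (D : F → ℝ) (ψ : ℂ × ℝ → F) (y : ℂ × ℝ) : ℝ :=
  fderiv ℝ D (ψ y) (Complex.I • transVec ψ y)

@[simp] theorem thicken_zero (ψ : ℂ × ℝ → F) (y : ℂ × ℝ) : thicken ψ (y, 0) = ψ y := by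
  simp [thicken]

@[simp] theorem thickenLeaf_zero (ψ : ℂ × ℝ → F) (y : ℂ × ℝ) :
    thickenLeaf ψ (y, 0) = leafVec ψ y := by
  simp [thickenLeaf]

theorem complex_smul_eq (c : ℂ) (v : F) : c • v = c.re • v + c.im • (Complex.I • v) := by
  conv_lhs => rw [← Complex.re_add_im c, add_smul, mul_smul]
  simp

theorem contDiffAt_I_smul {H : Type*} [NormedAddCommGroup H] [NormedSpace ℝ H] {f : H → F} {x : H}
    {n : WithTop ℕ∞} (hf : ContDiffAt ℝ n f x) : ContDiffAt ℝ n (fun y => Complex.I • f y) x :=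
  contDiffAt_const.smul hf

variable {D : F → ℝ} {ψ : ℂ × ℝ → F} {q : ℂ × ℝ}

theorem contDiffAt_leafVec (h : ContDiffAt ℝ 3 ψ q) : ContDiffAt ℝ 2 (leafVec ψ) q :=
  (h.fderiv_right (m := 2) (by norm_num)).clm_apply contDiffAt_const

theorem contDiffAt_transVec (h : ContDiffAt ℝ 3 ψ q) : ContDiffAt ℝ 2 (transVec ψ) q :=
  (h.fderiv_right (m := 2) (by norm_num)).clm_apply contDiffAt_const

theorem contDiffAt_twistVec (h : ContDiffAt ℝ 3 ψ q) : ContDiffAt ℝ 1 (twistVec ψ) q :=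
  ((contDiffAt_transVec h).fderiv_right (m := 1) (by norm_num)).clm_apply contDiffAt_const

theorem contDiffAt_thicken (h : ContDiffAt ℝ 3 ψ q) (s : ℝ) :
    ContDiffAt ℝ 2 (thicken ψ) (q, s) :=
  ((h.of_le (by norm_num)).comp (q, s) contDiffAt_fst).add
    (contDiffAt_snd.smul (contDiffAt_I_smul ((contDiffAt_transVec h).comp (q, s) contDiffAt_fst)))

theorem contDiffAt_thickenLeaf (h : ContDiffAt ℝ 3 ψ q) (s : ℝ) :
    ContDiffAt ℝ 1 (thickenLeaf ψ) (q, s) :=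
  (((contDiffAt_leafVec h).of_le (by norm_num)).comp (q, s) contDiffAt_fst).add
    (contDiffAt_snd.smul (contDiffAt_I_smul ((contDiffAt_twistVec h).comp (q, s) contDiffAt_fst)))

namespace IsFlatChart

theorem fderiv_leaf (h : IsFlatChart D ψ q) :
    ∀ᶠ y in 𝓝 q, ∀ w : ℂ, fderiv ℝ ψ y (w, 0) = w • leafVec ψ y := by
  filter_upwards [h.holomorphic, eventually_differentiableAt (n := 3) h.contDiffAt_param
    (by norm_num)] with y hy hd w
  have h1 : HasFDerivAt (fun z : ℂ => ((z, y.2) : ℂ × ℝ)) (ContinuousLinearMap.inl ℝ ℂ ℝ) y.1 :=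
    hasFDerivAt_prodMk_left y.1 y.2
  have h2 : HasFDerivAt (fun z => ψ (z, y.2)) ((fderiv ℝ ψ y).comp
      (ContinuousLinearMap.inl ℝ ℂ ℝ)) y.1 := hd.hasFDerivAt.comp y.1 h1
  have h3 : ∀ u : ℂ, fderiv ℝ ψ y (u, 0) = fderiv ℝ (fun z => ψ (z, y.2)) y.1 u := by
    intro u; rw [h2.fderiv]; simp
  rw [leafVec, h3, h3, ← fderiv_real_smul hy]
  simp

theorem fderiv_leafVec (h : IsFlatChart D ψ q) :
    ∀ᶠ y in 𝓝 q, fderiv ℝ (leafVec ψ) y (0, 1) = twistVec ψ y := by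
  filter_upwards [h.contDiffAt_param.eventually (by simp)] with y hy
  have hy2 : ContDiffAt ℝ 2 ψ y := hy.of_le (by norm_num)
  change fderiv ℝ (fun y => fderiv ℝ ψ y (1, 0)) y (0, 1)
    = fderiv ℝ (fun y => fderiv ℝ ψ y (0, 1)) y (1, 0)
  rw [fderiv_fderiv_apply_const hy2, fderiv_fderiv_apply_const hy2, fderiv_fderiv_symm hy2]

/-- Complex linearity along the leaves is differentiated in t and the order of differentiation
exchanged: ψ_t inherits holomorphy in z from ψ. -/
theorem fderiv_transVec (h : IsFlatChart D ψ q) :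
    ∀ᶠ y in 𝓝 q, ∀ w : ℂ, fderiv ℝ (transVec ψ) y (w, 0) = w • twistVec ψ y := by
  filter_upwards [h.contDiffAt_param.eventually (by simp), h.fderiv_leaf.eventually_nhds,
    h.fderiv_leafVec] with y hy hl hv w
  have hy2 : ContDiffAt ℝ 2 ψ y := hy.of_le (by norm_num)
  have h1 : (fun y => fderiv ℝ ψ y (w, 0)) =ᶠ[𝓝 y] fun y => w • leafVec ψ y := by
    filter_upwards [hl] with y' hy' using hy' w
  rw [← hv]
  change fderiv ℝ (fun y => fderiv ℝ ψ y (0, 1)) y (w, 0) = _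
  rw [fderiv_fderiv_apply_const hy2, fderiv_fderiv_symm hy2, ← fderiv_fderiv_apply_const hy2,
    h1.fderiv_eq, fderiv_fun_const_smul ((contDiffAt_leafVec hy).differentiableAt (by norm_num))]
  rfl

theorem contDiffAt_fun' (h : IsFlatChart D ψ q) :
    ∀ᶠ y in 𝓝 q, ContDiffAt ℝ 3 D (ψ y) :=
  h.contDiffAt_param.continuousAt.eventually (h.contDiffAt_fun.eventually (by simp))

theorem tangent (h : IsFlatChart D ψ q) :
    ∀ᶠ y in 𝓝 q, ∀ v, fderiv ℝ D (ψ y) (fderiv ℝ ψ y v) = 0 := by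
  filter_upwards [h.contDiffAt_fun', h.vanish.eventually_nhds,
    eventually_differentiableAt (n := 3) h.contDiffAt_param (by norm_num)] with y hD hv hd v
  have h1 : (D ∘ ψ) =ᶠ[𝓝 y] fun _ => 0 := hv
  have h2 := fderiv_comp y (hD.differentiableAt (by norm_num)) hd
  rw [h1.fderiv_eq] at h2
  have := congrArg (fun L => L v) h2
  simpa using this.symm

/-- D vanishes identically on each leaf, and the Levi form is natural under the holomorphic
parametrization of the leaf. -/
theorem levi_leafVec (h : IsFlatChart D ψ q) :
    ∀ᶠ y in 𝓝 q, flatLevi D (ψ y) (leafVec ψ y) = 0 := by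
  filter_upwards [h.contDiffAt_fun', h.vanish.eventually_nhds, h.holomorphic.eventually_nhds,
    h.contDiffAt_param.eventually (by simp)] with y hD hv hol hψ
  have hc : Continuous (fun z : ℂ => ((z, y.2) : ℂ × ℝ)) := by fun_prop
  have ht : Tendsto (fun z : ℂ => ((z, y.2) : ℂ × ℝ)) (𝓝 y.1) (𝓝 y) := hc.tendsto y.1
  have hs : ContDiffAt ℝ 2 (fun z : ℂ => ψ (z, y.2)) y.1 :=
    (hψ.of_le (by norm_num)).comp y.1 (contDiffAt_id.prodMk contDiffAt_const)
  have h1 := flatLevi_comp_holomorphic (f := D) (Ψ := fun z => ψ (z, y.2)) (x := y.1)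
    (hD.of_le (by norm_num)) hs (ht.eventually hol) 1
  have h2 : D ∘ (fun z => ψ (z, y.2)) =ᶠ[𝓝 y.1] fun _ => 0 := ht.eventually hv
  have h3 : fderiv ℝ (fun z : ℂ => ψ (z, y.2)) y.1 1 = leafVec ψ y := by
    have hd : HasFDerivAt ψ (fderiv ℝ ψ y) (y.1, y.2) :=
      (hψ.differentiableAt (by norm_num)).hasFDerivAt
    have h4 : HasFDerivAt (fun z : ℂ => ((z, y.2) : ℂ × ℝ)) (ContinuousLinearMap.inl ℝ ℂ ℝ) y.1 :=
      hasFDerivAt_prodMk_left y.1 y.2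
    rw [HasFDerivAt.fderiv (f := fun z : ℂ => ψ (z, y.2)) (hd.comp y.1 h4)]
    simp [leafVec]
  rw [flatLevi_congr h2, h3] at h1
  rw [← h1]
  simp [flatLevi]

theorem conormal_eq (h : IsFlatChart D ψ q) : fderiv ℝ D (ψ q) (transVec ψ q) = 0 :=
  h.tangent.self_of_nhds _

/-- A relation with nonzero coefficient on ψ_t would put ψ_t in the complex line of ψ_z. That line
is the image of the directions (w, 0), so injectivity of dψ would fail. -/
theorem linearIndependent (h : IsFlatChart D ψ q) :
    LinearIndependent ℂ ![leafVec ψ q, transVec ψ q] := by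
  have hz : ∀ w : ℂ, ∀ r : ℝ, w • leafVec ψ q + r • transVec ψ q = 0 → w = 0 ∧ r = 0 := by
    intro w r hwr
    rw [← h.fderiv_leaf.self_of_nhds, transVec, ← map_smul, ← map_add,
      ← map_zero (fderiv ℝ ψ q)] at hwr
    have := h.injective hwr
    simpa using this
  rw [LinearIndependent.pair_iff]
  intro b a hba
  have ha : a = 0 := by
    by_contra ha
    have h1 : (a⁻¹ * b) • leafVec ψ q + (1 : ℝ) • transVec ψ q = 0 := by
      have := congrArg (fun v => a⁻¹ • v) hba
      simpa [smul_add, smul_smul, ha] using this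
    exact one_ne_zero (hz _ _ h1).2
  subst ha
  refine ⟨(hz b 0 ?_).1, rfl⟩
  simpa using hba

theorem exists_combination (hF : Module.finrank ℂ F = 2) {v w : F}
    (h : LinearIndependent ℂ ![v, w]) (x : F) : ∃ b a : ℂ, x = b • v + a • w := by
  have : FiniteDimensional ℂ F := Module.finite_of_finrank_pos (by omega)
  have h1 := h.span_eq_top_of_card_eq_finrank' (by simp [hF])
  have h2 : x ∈ Submodule.span ℂ {v, w} := by
    have : x ∈ Submodule.span ℂ (Set.range ![v, w]) := by rw [h1]; trivial
    simpa [Set.pair_comm] using this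
  obtain ⟨b, a, hba⟩ := Submodule.mem_span_pair.1 h2
  exact ⟨b, a, hba.symm⟩

/-- The line ℂψ_z together with ψ_t and iψ_t spans the space over ℝ. The first two are tangent to
the hypersurface, so dD ≠ 0 must be seen on iψ_t. -/
theorem conormal_ne_zero (hF : Module.finrank ℂ F = 2) (h : IsFlatChart D ψ q) :
    conormal D ψ q ≠ 0 := by
  intro h0
  apply h.fderiv_ne
  ext x
  obtain ⟨b, a, rfl⟩ := exists_combination hF h.linearIndependent x
  rw [← h.fderiv_leaf.self_of_nhds, complex_smul_eq a, map_add, map_add, map_smul, map_smul,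
    h.tangent.self_of_nhds, h.conormal_eq]
  rw [conormal] at h0
  simp [h0]

/-- The derivative at (q, 0) is onto, so the map is open there. Equality of filters transports both
"eventually" and "frequently" between points and parameters. -/
theorem map_thicken_nhds (hF : Module.finrank ℂ F = 2) (h : IsFlatChart D ψ q) :
    map (thicken ψ) (𝓝 (q, 0)) = 𝓝 (ψ q) := by
  have : FiniteDimensional ℂ F := Module.finite_of_finrank_pos (by omega)
  have : CompleteSpace F := FiniteDimensional.complete ℂ F
  have h1 : HasStrictFDerivAt (thicken ψ) (fderiv ℝ (thicken ψ) (q, 0)) (q, 0) :=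
    (contDiffAt_thicken h.contDiffAt_param 0).hasStrictFDerivAt (by norm_num)
  have h2 : HasFDerivAt ψ (fderiv ℝ ψ q) q :=
    (h.contDiffAt_param.differentiableAt (by norm_num)).hasFDerivAt
  have h3 : HasFDerivAt (transVec ψ) (fderiv ℝ (transVec ψ) q) q :=
    ((contDiffAt_transVec h.contDiffAt_param).differentiableAt (by norm_num)).hasFDerivAt
  have h4 : ∀ w r s, fderiv ℝ (thicken ψ) (q, 0) ((w, r), s)
      = w • leafVec ψ q + r • transVec ψ q + s • (Complex.I • transVec ψ q) := by
    intro w r s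
    have e1 : HasFDerivAt (fun y : (ℂ × ℝ) × ℝ => y.1) (ContinuousLinearMap.fst ℝ (ℂ × ℝ) ℝ)
      (q, (0 : ℝ)) := hasFDerivAt_fst
    have e2 : HasFDerivAt (fun y : (ℂ × ℝ) × ℝ => y.2) (ContinuousLinearMap.snd ℝ (ℂ × ℝ) ℝ)
      (q, (0 : ℝ)) := hasFDerivAt_snd
    have e3 := (h2.comp (q, (0 : ℝ)) e1).add (e2.smul ((h3.comp (q, (0 : ℝ)) e1).const_smul
      Complex.I))
    rw [HasFDerivAt.fderiv (f := thicken ψ) e3]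
    have e4 : fderiv ℝ ψ q (w, r) = w • leafVec ψ q + r • transVec ψ q := by
      rw [← h.fderiv_leaf.self_of_nhds, transVec, ← map_smul, ← map_add]
      simp
    simp [e4]
  have h5 := h1.map_nhds_eq_of_surj (by
    rw [LinearMap.range_eq_top]
    intro x
    obtain ⟨b, a, rfl⟩ := exists_combination hF h.linearIndependent x
    refine ⟨((b, a.re), a.im), ?_⟩
    have := h4 b a.re a.im
    rw [complex_smul_eq a, ← add_assoc]
    exact this)
  simpa using h5

end IsFlatChart

end FlatChart

/-! ### Transverse limits -/

section Transverse

/-- Division of a function vanishing on `{s = 0}` by `s`. -/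
theorem tendsto_div_transverse {Y : Type*} [NormedAddCommGroup Y] [NormedSpace ℝ Y]
    {f : Y × ℝ → ℝ} {q : Y} {f' : ℝ} (hf : ContDiffAt ℝ 1 f (q, 0))
    (h0 : ∀ᶠ y in 𝓝 q, f (y, 0) = 0) (hd : HasDerivAt (fun s => f (q, s)) f' 0) :
    Tendsto (fun y => f y / y.2) (𝓝[{y | y.2 ≠ 0}] (q, 0)) (𝓝 f') := by
  have hs := hf.hasStrictFDerivAt one_ne_zero
  set L := fderiv ℝ f (q, 0)
  have hL : ∀ s : ℝ, L (0, s) = s * f' := by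
    intro s
    have h1 : HasFDerivAt (fun s : ℝ => ((q, s) : Y × ℝ)) (ContinuousLinearMap.inr ℝ Y ℝ) 0 :=
      hasFDerivAt_prodMk_right q 0
    have h2 : HasFDerivAt (fun s => f (q, s)) (L.comp (ContinuousLinearMap.inr ℝ Y ℝ)) 0 :=
      HasFDerivAt.comp (g := f) (f := fun s : ℝ => ((q, s) : Y × ℝ)) 0 hs.hasFDerivAt h1
    have h3 := h2.unique hd.hasFDerivAt
    have := congrArg (fun A => A s) h3
    simpa using this
  have hc : Tendsto (fun y : Y × ℝ => (y, (y.1, (0 : ℝ)))) (𝓝 (q, 0)) (𝓝 ((q, 0), (q, 0))) := by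
    have : Continuous (fun y : Y × ℝ => (y, (y.1, (0 : ℝ)))) := by fun_prop
    exact this.tendsto (q, 0)
  have h1 := (hs.isLittleO.comp_tendsto hc)
  have hfst : Tendsto (fun y : Y × ℝ => y.1) (𝓝 (q, 0)) (𝓝 q) := continuous_fst.tendsto (q, (0 : ℝ))
  have h2 : (fun y : Y × ℝ => f y - y.2 * f') =o[𝓝 (q, 0)] fun y => y.2 := by
    refine (h1.congr' ?_ (EventuallyEq.refl _ _)).trans_isBigO ?_
    · filter_upwards [hfst.eventually h0] with y hy
      have e : (y - (y.1, 0) : Y × ℝ) = (0, y.2) := by ext <;> simp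
      simp only [Function.comp_apply, hy, e, hL, sub_zero]
    · refine Asymptotics.IsBigO.of_bound 1 (Eventually.of_forall fun y => ?_)
      have e : (y - (y.1, 0) : Y × ℝ) = (0, y.2) := by ext <;> simp
      simp [e]
  have h3 := (h2.mono (nhdsWithin_le_nhds (s := {y | y.2 ≠ 0}))).tendsto_div_nhds_zero
  have h4 := h3.add_const f'
  rw [zero_add] at h4
  refine h4.congr' ?_
  filter_upwards [self_mem_nhdsWithin] with y hy
  have : y.2 ≠ 0 := hy
  field_simp
  ring

variable {F : Type*} [NormedAddCommGroup F] [NormedSpace ℂ F]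

theorem thirdDeriv_symm {D : F → ℝ} {x : F} (hD : ContDiffAt ℝ 3 D x) (u v : F) :
    fderiv ℝ (fderiv ℝ (fderiv ℝ D)) x u v v = fderiv ℝ (fderiv ℝ (fderiv ℝ D)) x v v u := by
  have h1 : ContDiffAt ℝ 2 (fderiv ℝ D) x := hD.fderiv_right (by norm_num)
  have hd : DifferentiableAt ℝ (fderiv ℝ (fderiv ℝ D)) x := differentiableAt_fderiv h1
  have h2 : ∀ a b : F, fderiv ℝ (fun y => fderiv ℝ (fderiv ℝ D) y a b) x v
      = fderiv ℝ (fderiv ℝ (fderiv ℝ D)) x v a b := by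
    intro a b
    have := (hd.hasFDerivAt.clm_apply (hasFDerivAt_const a x)).clm_apply (hasFDerivAt_const b x)
    rw [HasFDerivAt.fderiv (f := fun y => fderiv ℝ (fderiv ℝ D) y a b) this]
    simp
  have h3 : (fun y => fderiv ℝ (fderiv ℝ D) y u v) =ᶠ[𝓝 x]
      fun y => fderiv ℝ (fderiv ℝ D) y v u := by
    filter_upwards [hD.eventually (by simp)] with y hy
    exact fderiv_fderiv_symm (hy.of_le (by norm_num)) u v
  rw [fderiv_fderiv_symm h1, ← h2, h3.fderiv_eq, h2]

/-- The second derivative of `(x, ξ) ↦ D' (x) (ξ)` in the direction `(v, w)`. -/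
theorem fderiv_fderiv_tangentMap {D : F → ℝ} {x ξ : F} (hD : ContDiffAt ℝ 3 D x) (v w : F) :
    fderiv ℝ (fderiv ℝ fun y : F × F => fderiv ℝ D y.1 y.2) (x, ξ) (v, w) (v, w)
      = fderiv ℝ (fderiv ℝ (fderiv ℝ D)) x v v ξ + 2 * fderiv ℝ (fderiv ℝ D) x v w := by
  have hfst : Tendsto (fun y : F × F => y.1) (𝓝 (x, ξ)) (𝓝 x) := continuous_fst.tendsto (x, ξ)
  have hD1 : ContDiffAt ℝ 2 (fderiv ℝ D) x := hD.fderiv_right (by norm_num)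
  have hC : ContDiffAt ℝ 2 (fun y : F × F => fderiv ℝ D y.1 y.2) (x, ξ) :=
    ContDiffAt.clm_apply (hD1.comp (x, ξ) contDiffAt_fst) contDiffAt_snd
  have hfd : ∀ y : F × F, HasFDerivAt (fun y : F × F => y.1) (ContinuousLinearMap.fst ℝ F F) y :=
    fun y => hasFDerivAt_fst
  have hsd : ∀ y : F × F, HasFDerivAt (fun y : F × F => y.2) (ContinuousLinearMap.snd ℝ F F) y :=
    fun y => hasFDerivAt_snd
  have h1 : (fun y => fderiv ℝ (fun y : F × F => fderiv ℝ D y.1 y.2) y (v, w)) =ᶠ[𝓝 (x, ξ)]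
      fun y => fderiv ℝ D y.1 w + fderiv ℝ (fderiv ℝ D) y.1 v y.2 := by
    filter_upwards [hfst.eventually (hD.eventually (by simp))] with y hy
    have hy2 : ContDiffAt ℝ 2 D y.1 := hy.of_le (by norm_num)
    rw [(hasFDerivAt_fderiv_apply hy2 (hfd y) (hsd y)).fderiv]
    simp
  rw [← fderiv_fderiv_apply_const hC, h1.fderiv_eq]
  have hD2 : ContDiffAt ℝ 2 D x := hD.of_le (by norm_num)
  have e1 := hasFDerivAt_fderiv_apply (γ := fun y : F × F => y.1) (ξ := fun _ => w) (y := (x, ξ))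
    hD2 (hfd _) (hasFDerivAt_const w _)
  have e2 := hasFDerivAt_fderiv_apply (γ := fun y : F × F => y.1) (ξ := fun _ => v) (y := (x, ξ))
    hD1 (hfd _) (hasFDerivAt_const v _)
  have e3 := e1.add (e2.clm_apply (hsd (x, ξ)))
  rw [HasFDerivAt.fderiv
    (f := fun y : F × F => fderiv ℝ D y.1 w + fderiv ℝ (fderiv ℝ D) y.1 v y.2) e3]
  simp
  ring

theorem hasDerivAt_second {D : F → ℝ} {x ξ : F} (hD : ContDiffAt ℝ 3 D x) (v w : F) :
    HasDerivAt (fun s : ℝ => fderiv ℝ (fderiv ℝ D) (x + s • ξ) (v + s • w) (v + s • w))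
      (fderiv ℝ (fderiv ℝ (fderiv ℝ D)) x v v ξ + 2 * fderiv ℝ (fderiv ℝ D) x v w) 0 := by
  have hD1 : ContDiffAt ℝ 2 (fderiv ℝ D) x := hD.fderiv_right (by norm_num)
  have hl : ∀ a b : F, HasDerivAt (fun s : ℝ => a + s • b) b 0 := by
    intro a b
    simpa using ((hasDerivAt_id (0 : ℝ)).smul_const b).const_add a
  have hd : HasFDerivAt (fderiv ℝ (fderiv ℝ D)) (fderiv ℝ (fderiv ℝ (fderiv ℝ D)) x)
      (x + (0 : ℝ) • ξ) := by
    simpa using (differentiableAt_fderiv hD1).hasFDerivAt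
  have h1 : HasDerivAt (fun s : ℝ => fderiv ℝ (fderiv ℝ D) (x + s • ξ))
      (fderiv ℝ (fderiv ℝ (fderiv ℝ D)) x ξ) 0 :=
    HasFDerivAt.comp_hasDerivAt (l := fderiv ℝ (fderiv ℝ D)) (f := fun s : ℝ => x + s • ξ) 0 hd (hl x ξ)
  have h2 := (h1.clm_apply (hl v w)).clm_apply (hl v w)
  refine h2.congr_deriv ?_
  simp only [zero_smul, add_zero, thirdDeriv_symm hD ξ v, _root_.add_apply,
    fderiv_fderiv_symm (hD.of_le (by norm_num) : ContDiffAt ℝ 2 D x) w v]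
  ring

/-- The Levi form of `(x, ξ) ↦ D' (x) (ξ)` is the derivative of the Levi form of `D`. -/
theorem hasDerivAt_flatLevi {D : F → ℝ} {x ξ : F} (hD : ContDiffAt ℝ 3 D x) (v w : F) :
    HasDerivAt (fun s : ℝ => flatLevi D (x + s • ξ) (v + s • w))
      (flatLevi (fun y : F × F => fderiv ℝ D y.1 y.2) (x, ξ) (v, w)) 0 := by
  have h1 := ((hasDerivAt_second (ξ := ξ) hD v w).add
    (hasDerivAt_second (ξ := ξ) hD (Complex.I • v) (Complex.I • w))).div_const 4
  have h2 : (Complex.I • (v, w) : F × F) = (Complex.I • v, Complex.I • w) := rfl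
  simp only [flatLevi, smul_add, h2, fderiv_fderiv_tangentMap hD]
  refine h1.congr_of_eventuallyEq (Eventually.of_forall fun s => ?_)
  simp only [smul_comm Complex.I s]
  rfl

end Transverse

/-! ### Transverse quotients of the defining function, its differential and its Levi form -/

section FlatChart

variable {F : Type*} [NormedAddCommGroup F] [NormedSpace ℂ F]
variable {D : F → ℝ} {ψ : ℂ × ℝ → F} {q : ℂ × ℝ}

/-- The restriction of the transverse derivative to a leaf. -/
noncomputable def leafConormal (D : F → ℝ) (ψ : ℂ × ℝ → F) (t : ℝ) (z : ℂ) : ℝ :=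
  conormal D ψ (z, t)

namespace IsFlatChart

theorem tendsto_slice (q : ℂ × ℝ) :
    Tendsto (fun z : ℂ => ((z, q.2) : ℂ × ℝ)) (𝓝 q.1) (𝓝 q) := by
  have : Continuous (fun z : ℂ => ((z, q.2) : ℂ × ℝ)) := by fun_prop
  exact this.tendsto q.1

theorem hasFDerivAt_slice {G : Type*} [NormedAddCommGroup G] [NormedSpace ℝ G] {f : ℂ × ℝ → G}
    {q : ℂ × ℝ} (hf : DifferentiableAt ℝ f q) :
    HasFDerivAt (fun z : ℂ => f (z, q.2)) ((fderiv ℝ f q).comp (ContinuousLinearMap.inl ℝ ℂ ℝ))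
      q.1 :=
  HasFDerivAt.comp (g := f) (f := fun z : ℂ => ((z, q.2) : ℂ × ℝ)) q.1 hf.hasFDerivAt
    (hasFDerivAt_prodMk_left q.1 q.2)

theorem hasFDerivAt_slice_param (h : IsFlatChart D ψ q) :
    HasFDerivAt (fun z : ℂ => ψ (z, q.2))
      ((ContinuousLinearMap.toSpanSingleton ℂ (leafVec ψ q)).restrictScalars ℝ) q.1 := by
  refine (hasFDerivAt_slice (h.contDiffAt_param.differentiableAt (by norm_num))).congr_fderiv ?_
  ext w
  simpa using h.fderiv_leaf.self_of_nhds w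

theorem hasFDerivAt_slice_transVec (h : IsFlatChart D ψ q) :
    ∀ᶠ y in 𝓝 q, HasFDerivAt (fun z : ℂ => Complex.I • transVec ψ (z, y.2))
      (ContinuousLinearMap.toSpanSingleton ℂ (Complex.I • twistVec ψ y)) y.1 := by
  filter_upwards [h.fderiv_transVec, eventually_differentiableAt (n := 2)
    (contDiffAt_transVec h.contDiffAt_param) (by norm_num)] with y hy hd
  refine hasFDerivAt_of_restrictScalars ℝ ((hasFDerivAt_slice hd).const_smul Complex.I) ?_
  ext w
  have := hy w
  simp only [ContinuousLinearMap.coe_restrictScalars', ContinuousLinearMap.toSpanSingleton_apply,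
    _root_.smul_apply, ContinuousLinearMap.comp_apply, ContinuousLinearMap.inl_apply,
    this, smul_comm w]

theorem hasFDerivAt_pair (h : IsFlatChart D ψ q) :
    HasFDerivAt (fun z : ℂ => (ψ (z, q.2), Complex.I • transVec ψ (z, q.2)))
      (((ContinuousLinearMap.toSpanSingleton ℂ (leafVec ψ q)).restrictScalars ℝ).prod
        ((ContinuousLinearMap.toSpanSingleton ℂ
          (Complex.I • twistVec ψ q)).restrictScalars ℝ)) q.1 :=
  h.hasFDerivAt_slice_param.prodMk
    (h.hasFDerivAt_slice_transVec.self_of_nhds.restrictScalars ℝ)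

theorem contDiffAt_leafConormal (h : IsFlatChart D ψ q) :
    ContDiffAt ℝ 2 (leafConormal D ψ q.2) q.1 := by
  have h1 : ContDiffAt ℝ 2 (fun z : ℂ => ((z, q.2) : ℂ × ℝ)) q.1 :=
    contDiffAt_id.prodMk contDiffAt_const
  have h2 : ContDiffAt ℝ 2 (conormal D ψ) q :=
    ContDiffAt.clm_apply ((h.contDiffAt_fun.fderiv_right (m := 2) (by norm_num)).comp q
      (h.contDiffAt_param.of_le (by norm_num)))
      (contDiffAt_I_smul (contDiffAt_transVec h.contDiffAt_param))
  exact h2.comp (f := fun z : ℂ => ((z, q.2) : ℂ × ℝ)) q.1 h1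

theorem fderiv_leafConormal (h : IsFlatChart D ψ q) (w : ℂ) :
    fderiv ℝ (leafConormal D ψ q.2) q.1 w
      = fderiv ℝ D (ψ q) (w • Complex.I • twistVec ψ q)
        + fderiv ℝ (fderiv ℝ D) (ψ q) (w • leafVec ψ q) (Complex.I • transVec ψ q) := by
  have h1 := hasFDerivAt_fderiv_apply (f := D) (y := q.1) (γ := fun z : ℂ => ψ (z, q.2))
    (h.contDiffAt_fun.of_le (by norm_num)) h.hasFDerivAt_slice_param
    (h.hasFDerivAt_slice_transVec.self_of_nhds.restrictScalars ℝ)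
  rw [HasFDerivAt.fderiv (f := leafConormal D ψ q.2) h1]
  simp

/-- Along a leaf, z ↦ (ψ, iψ_t) is holomorphic, and H is its composition with (x, ξ) ↦ D'(x)ξ, which
is C² because D is C³. Naturality of the Levi form applies, and `hasDerivAt_flatLevi` reads the
result as a transverse derivative. -/
theorem flatLevi_leafConormal (h : IsFlatChart D ψ q) :
    flatLevi (leafConormal D ψ q.2) q.1 1
      = flatLevi (fun y : F × F => fderiv ℝ D y.1 y.2) (ψ q, Complex.I • transVec ψ q)
        (leafVec ψ q, Complex.I • twistVec ψ q) := by
  have hD1 : ContDiffAt ℝ 2 (fderiv ℝ D) (ψ q) := h.contDiffAt_fun.fderiv_right (by norm_num)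
  have hC : ContDiffAt ℝ 2 (fun y : F × F => fderiv ℝ D y.1 y.2)
      (ψ q, Complex.I • transVec ψ q) :=
    ContDiffAt.clm_apply (hD1.comp (ψ q, Complex.I • transVec ψ q) contDiffAt_fst) contDiffAt_snd
  have h1 : ContDiffAt ℝ 2 (fun z : ℂ => ((z, q.2) : ℂ × ℝ)) q.1 :=
    contDiffAt_id.prodMk contDiffAt_const
  have h2 : ContDiffAt ℝ 2 (fun z : ℂ => (ψ (z, q.2), Complex.I • transVec ψ (z, q.2))) q.1 :=
    ContDiffAt.prodMk
      ((h.contDiffAt_param.of_le (by norm_num)).comp (f := fun z : ℂ => ((z, q.2) : ℂ × ℝ)) q.1 h1)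
      (contDiffAt_I_smul ((contDiffAt_transVec h.contDiffAt_param).comp
        (f := fun z : ℂ => ((z, q.2) : ℂ × ℝ)) q.1 h1))
  have h3 : ∀ᶠ z in 𝓝 q.1, DifferentiableAt ℂ
      (fun z : ℂ => (ψ (z, q.2), Complex.I • transVec ψ (z, q.2))) z := by
    filter_upwards [(tendsto_slice q).eventually h.holomorphic,
      (tendsto_slice q).eventually h.hasFDerivAt_slice_transVec] with z hz1 hz2
    exact hz1.prodMk hz2.differentiableAt
  have h4 := flatLevi_comp_holomorphic
    (Ψ := fun z : ℂ => (ψ (z, q.2), Complex.I • transVec ψ (z, q.2))) (x := q.1) hC h2 h3 1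
  rw [h.hasFDerivAt_pair.fderiv] at h4
  have h5 : (fun y : F × F => fderiv ℝ D y.1 y.2) ∘
    (fun z : ℂ => (ψ (z, q.2), Complex.I • transVec ψ (z, q.2))) = leafConormal D ψ q.2 := rfl
  rw [h5] at h4
  simpa using h4

theorem continuousAt_thicken (h : IsFlatChart D ψ q) : ContinuousAt (thicken ψ) (q, 0) :=
  (contDiffAt_thicken h.contDiffAt_param 0).continuousAt

theorem tendsto_fun_div (h : IsFlatChart D ψ q) :
    Tendsto (fun y => D (thicken ψ y) / y.2) (𝓝[{y | y.2 ≠ 0}] (q, 0))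
      (𝓝 (conormal D ψ q)) := by
  refine tendsto_div_transverse (f := fun y => D (thicken ψ y)) ?_ ?_ ?_
  · refine ContDiffAt.comp (q, (0 : ℝ)) (g := D) ?_
      ((contDiffAt_thicken h.contDiffAt_param 0).of_le (by norm_num))
    simpa using h.contDiffAt_fun.of_le (by norm_num)
  · filter_upwards [h.vanish] with y hy
    simpa using hy
  · have hd : HasFDerivAt D (fderiv ℝ D (ψ q)) (ψ q + (0 : ℝ) • (Complex.I • transVec ψ q)) := by
      simpa using (h.contDiffAt_fun.differentiableAt (by norm_num)).hasFDerivAt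
    have hl : HasDerivAt (fun s : ℝ => ψ q + s • (Complex.I • transVec ψ q))
        (Complex.I • transVec ψ q) 0 := by
      simpa using ((hasDerivAt_id (0 : ℝ)).smul_const (Complex.I • transVec ψ q)).const_add (ψ q)
    exact HasFDerivAt.comp_hasDerivAt (f := fun s : ℝ => ψ q + s • (Complex.I • transVec ψ q)) 0
      hd hl

theorem tendsto_fderiv_div (h : IsFlatChart D ψ q) (w : ℂ) :
    Tendsto (fun y => fderiv ℝ D (thicken ψ y) (w • thickenLeaf ψ y) / y.2)
      (𝓝[{y | y.2 ≠ 0}] (q, 0)) (𝓝 (fderiv ℝ (leafConormal D ψ q.2) q.1 w)) := by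
  refine tendsto_div_transverse
    (f := fun y => fderiv ℝ D (thicken ψ y) (w • thickenLeaf ψ y)) ?_ ?_ ?_
  · refine ContDiffAt.clm_apply (ContDiffAt.comp (q, (0 : ℝ)) (g := fderiv ℝ D) ?_
      ((contDiffAt_thicken h.contDiffAt_param 0).of_le (by norm_num)))
      (contDiffAt_const.smul (contDiffAt_thickenLeaf h.contDiffAt_param 0))
    simpa using h.contDiffAt_fun.fderiv_right (m := 1) (by norm_num)
  · filter_upwards [h.tangent, h.fderiv_leaf] with y hy hl
    simp [← hl, hy]
  · have hl : ∀ a b : F, HasDerivAt (fun s : ℝ => a + s • b) b 0 := by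
      intro a b
      simpa using ((hasDerivAt_id (0 : ℝ)).smul_const b).const_add a
    have hD : ContDiffAt ℝ 2 D (ψ q) := h.contDiffAt_fun.of_le (by norm_num)
    have h1 := hasFDerivAt_fderiv_apply (f := D) (y := (0 : ℝ))
      (γ := fun s : ℝ => ψ q + s • (Complex.I • transVec ψ q)) (by simpa using hD)
      (hl _ _).hasFDerivAt ((hl (leafVec ψ q) (Complex.I • twistVec ψ q)).const_smul w).hasFDerivAt
    refine h1.hasDerivAt.congr_deriv ?_
    rw [h.fderiv_leafConormal, fderiv_fderiv_symm hD]
    simp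

/-- The numerator vanishes at s = 0 by `levi_leafVec`. The correction s·iψ_zt built into
`thickenLeaf` makes its transverse derivative exactly the leafwise Levi form of H. -/
theorem tendsto_flatLevi_div (h : IsFlatChart D ψ q) :
    Tendsto (fun y => flatLevi D (thicken ψ y) (thickenLeaf ψ y) / y.2)
      (𝓝[{y | y.2 ≠ 0}] (q, 0)) (𝓝 (flatLevi (leafConormal D ψ q.2) q.1 1)) := by
  refine tendsto_div_transverse
    (f := fun y => flatLevi D (thicken ψ y) (thickenLeaf ψ y)) ?_ ?_ ?_
  · have h1 : ContDiffAt ℝ 1 (fun y => fderiv ℝ (fderiv ℝ D) (thicken ψ y)) (q, 0) := by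
      refine ContDiffAt.comp (q, (0 : ℝ)) (g := fderiv ℝ (fderiv ℝ D)) ?_
        ((contDiffAt_thicken h.contDiffAt_param 0).of_le (by norm_num))
      simpa using (h.contDiffAt_fun.fderiv_right (m := 2) (by norm_num)).fderiv_right (m := 1)
        (by norm_num)
    have h2 := contDiffAt_thickenLeaf h.contDiffAt_param 0
    have h3 : ContDiffAt ℝ 1 (fun y => Complex.I • thickenLeaf ψ y) (q, 0) := contDiffAt_I_smul h2
    have h4 : ContDiffAt ℝ 1 (fun y => fderiv ℝ (fderiv ℝ D) (thicken ψ y) (thickenLeaf ψ y)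
        (thickenLeaf ψ y)) (q, 0) := (h1.clm_apply h2).clm_apply h2
    have h5 : ContDiffAt ℝ 1 (fun y => fderiv ℝ (fderiv ℝ D) (thicken ψ y)
        (Complex.I • thickenLeaf ψ y) (Complex.I • thickenLeaf ψ y)) (q, 0) :=
      (h1.clm_apply h3).clm_apply h3
    have h6 := (h4.add h5).div_const 4
    exact h6
  · filter_upwards [h.levi_leafVec] with y hy
    simpa using hy
  · rw [h.flatLevi_leafConormal]
    simp only [thicken, thickenLeaf]
    exact hasDerivAt_flatLevi (ξ := Complex.I • transVec ψ q) h.contDiffAt_fun (leafVec ψ q)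
      (Complex.I • twistVec ψ q)

/-- The polarized Levi form at the boundary, in terms of the transverse derivative. -/
theorem levi_mixed (h : IsFlatChart D ψ q) :
    fderiv ℝ (fderiv ℝ D) (ψ q) (leafVec ψ q) (transVec ψ q)
      + fderiv ℝ (fderiv ℝ D) (ψ q) (Complex.I • leafVec ψ q) (Complex.I • transVec ψ q)
        = fderiv ℝ (leafConormal D ψ q.2) q.1 Complex.I ∧
    fderiv ℝ (fderiv ℝ D) (ψ q) (leafVec ψ q) (Complex.I • transVec ψ q)
      - fderiv ℝ (fderiv ℝ D) (ψ q) (Complex.I • leafVec ψ q) (transVec ψ q)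
        = fderiv ℝ (leafConormal D ψ q.2) q.1 1 := by
  have hD : ContDiffAt ℝ 2 D (ψ q) := h.contDiffAt_fun.of_le (by norm_num)
  have h1 : ∀ w : ℂ, fderiv ℝ (fderiv ℝ D) (ψ q) (w • leafVec ψ q) (transVec ψ q)
      = -fderiv ℝ D (ψ q) (w • twistVec ψ q) := by
    intro w
    -- The tangency identity D'(ψ)(wψ_z) = 0 is differentiated in t.
    have e1 : (fun y => fderiv ℝ D (ψ y) (w • leafVec ψ y)) =ᶠ[𝓝 q] fun _ => 0 := by
      filter_upwards [h.tangent, h.fderiv_leaf] with y hy hl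
      rw [← hl, hy]
    have e2 := hasFDerivAt_fderiv_apply (f := D) hD
      (h.contDiffAt_param.differentiableAt (by norm_num)).hasFDerivAt
      (((contDiffAt_leafVec h.contDiffAt_param).differentiableAt
        (by norm_num)).hasFDerivAt.const_smul w)
    have e3 := congrArg (fun L => L ((0, 1) : ℂ × ℝ)) (e2.fderiv.symm.trans e1.fderiv_eq)
    have e4 := h.fderiv_leafVec.self_of_nhds
    simp only [_root_.add_apply, ContinuousLinearMap.comp_apply, _root_.smul_apply, e4,
      ContinuousLinearMap.flip_apply] at e3
    rw [fderiv_fderiv_symm hD]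
    have e5 : fderiv ℝ ψ q (0, 1) = transVec ψ q := rfl
    rw [e5] at e3
    simp at e3
    linarith
  have h2 := h1 1
  have h3 := h1 Complex.I
  rw [one_smul, one_smul] at h2
  rw [h.fderiv_leafConormal, h.fderiv_leafConormal, h2, h3, smul_smul Complex.I Complex.I,
    Complex.I_mul_I]
  simp only [neg_smul, one_smul, map_neg]
  exact ⟨trivial, by ring⟩

end IsFlatChart

end FlatChart

/-! ### The limit of the complex Hessian at the boundary -/

/-- The limit at the boundary of the rescaled form `exponentForm`, where `H` is the transverse
derivative, `K₁`, `K₂` are its leafwise partial derivatives, and `L` is its leafwise Levi form. -/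
noncomputable def modelForm (H L K₁ K₂ c : ℝ) (b a : ℂ) : ℝ :=
  -H * ((b.re ^ 2 + b.im ^ 2) * L
      + ((b.re * a.re + b.im * a.im) * K₂ + (b.re * a.im - b.im * a.re) * K₁) / 2)
    + c * ((b.re * K₁ + b.im * K₂ + a.im * H) ^ 2 + (b.re * K₂ - b.im * K₁ + a.re * H) ^ 2) / 4

/-- Completion of the square in a. The last bracket is H²(c(Θ + A) - A), the quantity that decides
positivity; the factor c on the left avoids a division. -/
theorem modelForm_eq (H L K₁ K₂ c : ℝ) (b a : ℂ) :
    c * modelForm H L K₁ K₂ c b a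
      = ((c * (b.re * K₁ + b.im * K₂ + a.im * H) - (b.re * K₁ + b.im * K₂)) ^ 2
          + (c * (b.re * K₂ - b.im * K₁ + a.re * H) - (b.re * K₂ - b.im * K₁)) ^ 2) / 4
        + (b.re ^ 2 + b.im ^ 2)
          * (c * (-H * L + (K₁ ^ 2 + K₂ ^ 2) / 2) - (K₁ ^ 2 + K₂ ^ 2) / 4) := by
  rw [modelForm]
  ring

theorem modelForm_pos {H L K₁ K₂ c : ℝ} (hH : H ≠ 0) (hc : 0 < c)
    (h : (K₁ ^ 2 + K₂ ^ 2) / 4 < c * (-H * L + (K₁ ^ 2 + K₂ ^ 2) / 2)) {b a : ℂ}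
    (hba : (b, a) ≠ 0) : 0 < modelForm H L K₁ K₂ c b a := by
  refine pos_of_mul_pos_right (a := c) ?_ hc.le
  rw [modelForm_eq]
  -- For b = 0 the last term disappears and the squares alone contribute c²H²|a|²/4; otherwise the
  -- last term is already positive.
  by_cases hb : b = 0
  · subst hb
    have ha : a ≠ 0 := fun ha => hba (by rw [ha]; rfl)
    have h2 : 0 < a.re ^ 2 + a.im ^ 2 := by
      have := Complex.normSq_pos.2 ha
      rw [Complex.normSq_apply] at this
      linarith [sq a.re, sq a.im]
    have h3 : 0 < (c * H) ^ 2 * (a.re ^ 2 + a.im ^ 2) := by positivity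
    simp only [Complex.zero_re, Complex.zero_im]
    linarith
  · have h2 : 0 < b.re ^ 2 + b.im ^ 2 := by
      have := Complex.normSq_pos.2 hb
      rw [Complex.normSq_apply] at this
      linarith [sq b.re, sq b.im]
    have h3 := mul_pos h2 (sub_pos.2 h)
    have h4 : 0 ≤ ((c * (b.re * K₁ + b.im * K₂ + a.im * H) - (b.re * K₁ + b.im * K₂)) ^ 2
        + (c * (b.re * K₂ - b.im * K₁ + a.re * H) - (b.re * K₂ - b.im * K₁)) ^ 2) / 4 := by
      positivity
    linarith

theorem exists_modelForm_eq {H L K₁ K₂ c : ℝ} (hH : H ≠ 0) (hc : 0 < c) :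
    ∃ a : ℂ, c * modelForm H L K₁ K₂ c 1 a
      = c * (-H * L + (K₁ ^ 2 + K₂ ^ 2) / 2) - (K₁ ^ 2 + K₂ ^ 2) / 4 := by
  -- The real and imaginary parts are those that make both squares in `modelForm_eq` vanish at b =
  -- 1.
  refine ⟨⟨(K₂ / c - K₂) / H, (K₁ / c - K₁) / H⟩, ?_⟩
  rw [modelForm_eq]
  simp only [Complex.one_re, Complex.one_im]
  field_simp
  ring

/-! ### Expansion of the quadratic form in leaf and normal directions -/

section Expansion

variable {F : Type*} [NormedAddCommGroup F] [NormedSpace ℂ F]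

/-- The polarized Levi form. -/
noncomputable def leviMixed (D : F → ℝ) (x v w : F) : ℝ :=
  (fderiv ℝ (fderiv ℝ D) x v w + fderiv ℝ (fderiv ℝ D) x w v
    + fderiv ℝ (fderiv ℝ D) x (Complex.I • v) (Complex.I • w)
    + fderiv ℝ (fderiv ℝ D) x (Complex.I • w) (Complex.I • v)) / 4

theorem flatLevi_add (D : F → ℝ) (x v w : F) :
    flatLevi D x (v + w) = flatLevi D x v + leviMixed D x v w + flatLevi D x w := by
  simp only [flatLevi, leviMixed, smul_add, map_add, _root_.add_apply]
  ring

theorem flatLevi_real_smul (D : F → ℝ) (x : F) (s : ℝ) (v : F) :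
    flatLevi D x (s • v) = s ^ 2 * flatLevi D x v := by
  simp only [flatLevi, smul_comm Complex.I s v, map_smul, _root_.smul_apply, smul_eq_mul]
  ring

theorem leviMixed_real_smul (D : F → ℝ) (x : F) (s : ℝ) (v w : F) :
    leviMixed D x v (s • w) = s * leviMixed D x v w := by
  simp only [leviMixed, smul_comm Complex.I s w, map_smul, _root_.smul_apply, smul_eq_mul]
  ring

theorem I_smul_complex_smul (c : ℂ) (v : F) :
    Complex.I • c • v = c.re • (Complex.I • v) - c.im • v := by
  rw [complex_smul_eq c v, smul_add, smul_comm Complex.I c.re, smul_comm Complex.I c.im, smul_smul,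
    Complex.I_mul_I, neg_one_smul, smul_neg, sub_eq_add_neg]

theorem flatLevi_complex_smul (D : F → ℝ) (x : F) (c : ℂ) (v : F) :
    flatLevi D x (c • v) = (c.re ^ 2 + c.im ^ 2) * flatLevi D x v := by
  rw [flatLevi, I_smul_complex_smul, complex_smul_eq c v]
  simp only [flatLevi, map_add, map_sub, map_smul, _root_.add_apply, _root_.sub_apply,
    _root_.smul_apply, smul_eq_mul]
  ring

theorem leviMixed_complex_smul (D : F → ℝ) {x : F} (hD : ContDiffAt ℝ 2 D x) (b a : ℂ) (v w : F) :
    leviMixed D x (b • v) (a • w)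
      = ((b.re * a.re + b.im * a.im) * (fderiv ℝ (fderiv ℝ D) x v w
          + fderiv ℝ (fderiv ℝ D) x (Complex.I • v) (Complex.I • w))
        + (b.re * a.im - b.im * a.re) * (fderiv ℝ (fderiv ℝ D) x v (Complex.I • w)
          - fderiv ℝ (fderiv ℝ D) x (Complex.I • v) w)) / 2 := by
  rw [leviMixed, fderiv_fderiv_symm hD (a • w), fderiv_fderiv_symm hD (Complex.I • a • w),
    I_smul_complex_smul, I_smul_complex_smul, complex_smul_eq b v, complex_smul_eq a w]
  simp only [map_add, map_sub, map_smul, _root_.add_apply, _root_.sub_apply,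
    _root_.smul_apply, smul_eq_mul]
  ring

/-- With the normal part weighted by s, division by s² leaves only quotients by s with known limits
and continuous terms. -/
theorem exponentForm_expand (D : F → ℝ) (c : ℝ) (x T N : F) (b a : ℂ) {s : ℝ} (hs : s ≠ 0) :
    exponentForm D c x (b • T + s • (a • N)) / s ^ 2 =
      -(D x / s) * ((b.re ^ 2 + b.im ^ 2) * (flatLevi D x T / s)
          + leviMixed D x (b • T) (a • N) + s * flatLevi D x (a • N))
        + c * ((b.re * (fderiv ℝ D x ((1 : ℂ) • T) / s) + b.im * (fderiv ℝ D x (Complex.I • T) / s)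
              + fderiv ℝ D x (a • N)) ^ 2
            + (b.re * (fderiv ℝ D x (Complex.I • T) / s) - b.im * (fderiv ℝ D x ((1 : ℂ) • T) / s)
              + fderiv ℝ D x (Complex.I • a • N)) ^ 2) / 4 := by
  have h1 : fderiv ℝ D x (b • T + s • (a • N))
      = b.re * fderiv ℝ D x T + b.im * fderiv ℝ D x (Complex.I • T)
        + s * fderiv ℝ D x (a • N) := by
    rw [complex_smul_eq b T]
    simp only [map_add, map_smul, smul_eq_mul]
  have h2 : fderiv ℝ D x (Complex.I • (b • T + s • (a • N)))
      = b.re * fderiv ℝ D x (Complex.I • T) - b.im * fderiv ℝ D x T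
        + s * fderiv ℝ D x (Complex.I • a • N) := by
    rw [smul_add, smul_comm Complex.I s, I_smul_complex_smul b T]
    simp only [map_add, map_sub, map_smul, smul_eq_mul]
  rw [exponentForm, normSqPartial, h1, h2, flatLevi_add, flatLevi_real_smul, leviMixed_real_smul,
    flatLevi_complex_smul, one_smul]
  field_simp

theorem tendsto_clm_apply {α G H : Type*} [NormedAddCommGroup G] [NormedSpace ℝ G]
    [NormedAddCommGroup H] [NormedSpace ℝ H] {l : Filter α} {L : α → G →L[ℝ] H} {f : α → G}
    {L₀ : G →L[ℝ] H} {v : G} (hL : Tendsto L l (𝓝 L₀)) (hf : Tendsto f l (𝓝 v)) :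
    Tendsto (fun p => L p (f p)) l (𝓝 (L₀ v)) :=
  (isBoundedBilinearMap_apply.continuous.tendsto (L₀, v)).comp (hL.prodMk_nhds hf)

end Expansion

/-! ### Convergence to the model form and its consequences -/

namespace IsFlatChart

variable {F : Type*} [NormedAddCommGroup F] [NormedSpace ℂ F]
variable {D : F → ℝ} {ψ : ℂ × ℝ → F} {q : ℂ × ℝ}

/-- `modelForm` for the transverse derivative of `D` in the chart `ψ`. -/
noncomputable def chartModelForm (D : F → ℝ) (ψ : ℂ × ℝ → F) (q : ℂ × ℝ) (c : ℝ) (b a : ℂ) : ℝ :=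
  modelForm (conormal D ψ q) (flatLevi (leafConormal D ψ q.2) q.1 1)
    (fderiv ℝ (leafConormal D ψ q.2) q.1 1) (fderiv ℝ (leafConormal D ψ q.2) q.1 Complex.I) c b a

/-- The mixed second derivatives at the boundary are rewritten through dH by `levi_mixed`, and the
purely normal Levi term drops out because it keeps a factor s. The limit is joint in the point and
the coefficients, as the compactness argument requires. -/
theorem tendsto_exponentForm (h : IsFlatChart D ψ q) (c : ℝ) (b₀ a₀ : ℂ) :
    Tendsto (fun p : ((ℂ × ℝ) × ℝ) × (ℂ × ℂ) =>
        exponentForm D c (thicken ψ p.1) (p.2.1 • thickenLeaf ψ p.1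
          + p.1.2 • (p.2.2 • transVec ψ p.1.1)) / p.1.2 ^ 2)
      (𝓝[{p | p.1.2 ≠ 0}] ((q, 0), (b₀, a₀))) (𝓝 (chartModelForm D ψ q c b₀ a₀)) := by
  set ℱ := 𝓝[{p : ((ℂ × ℝ) × ℝ) × (ℂ × ℂ) | p.1.2 ≠ 0}] ((q, 0), (b₀, a₀)) with hℱ
  have hle : ℱ ≤ 𝓝 ((q, 0), (b₀, a₀)) := nhdsWithin_le_nhds
  have hfst : Tendsto (fun p : ((ℂ × ℝ) × ℝ) × (ℂ × ℂ) => p.1) ℱ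
      (𝓝[{y | y.2 ≠ 0}] (q, 0)) :=
    tendsto_nhdsWithin_iff.2 ⟨(continuous_fst.tendsto _).mono_left hle, self_mem_nhdsWithin⟩
  have hfst' : Tendsto (fun p : ((ℂ × ℝ) × ℝ) × (ℂ × ℂ) => p.1) ℱ (𝓝 (q, 0)) :=
    hfst.mono_right nhdsWithin_le_nhds
  have hs : Tendsto (fun p : ((ℂ × ℝ) × ℝ) × (ℂ × ℂ) => p.1.2) ℱ (𝓝 0) :=
    (continuous_snd.tendsto (q, (0 : ℝ))).comp hfst'
  have hb : Tendsto (fun p : ((ℂ × ℝ) × ℝ) × (ℂ × ℂ) => p.2.1) ℱ (𝓝 b₀) :=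
    ((continuous_fst.comp continuous_snd).tendsto ((q, (0 : ℝ)), (b₀, a₀))).mono_left hle
  have ha : Tendsto (fun p : ((ℂ × ℝ) × ℝ) × (ℂ × ℂ) => p.2.2) ℱ (𝓝 a₀) :=
    ((continuous_snd.comp continuous_snd).tendsto ((q, (0 : ℝ)), (b₀, a₀))).mono_left hle
  have hre : ∀ {f : ((ℂ × ℝ) × ℝ) × (ℂ × ℂ) → ℂ} {l : ℂ}, Tendsto f ℱ (𝓝 l) →
      Tendsto (fun p => (f p).re) ℱ (𝓝 l.re) :=
    fun hf => (Complex.continuous_re.tendsto _).comp hf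
  have him : ∀ {f : ((ℂ × ℝ) × ℝ) × (ℂ × ℂ) → ℂ} {l : ℂ}, Tendsto f ℱ (𝓝 l) →
      Tendsto (fun p => (f p).im) ℱ (𝓝 l.im) :=
    fun hf => (Complex.continuous_im.tendsto _).comp hf
  have hD0 : Tendsto (fun p : ((ℂ × ℝ) × ℝ) × (ℂ × ℂ) => thicken ψ p.1) ℱ (𝓝 (ψ q)) := by
    have := h.continuousAt_thicken.tendsto.comp hfst'
    simpa [Function.comp_def] using this
  have hT : Tendsto (fun p : ((ℂ × ℝ) × ℝ) × (ℂ × ℂ) => thickenLeaf ψ p.1) ℱ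
      (𝓝 (leafVec ψ q)) := by
    have := (contDiffAt_thickenLeaf h.contDiffAt_param 0).continuousAt.tendsto.comp hfst'
    simpa [Function.comp_def] using this
  have hN : Tendsto (fun p : ((ℂ × ℝ) × ℝ) × (ℂ × ℂ) => transVec ψ p.1.1) ℱ
      (𝓝 (transVec ψ q)) :=
    (contDiffAt_transVec h.contDiffAt_param).continuousAt.tendsto.comp
      ((continuous_fst.tendsto (q, (0 : ℝ))).comp hfst')
  have hbT := hb.smul hT
  have haN := ha.smul hN
  have hD1 : Tendsto (fun p : ((ℂ × ℝ) × ℝ) × (ℂ × ℂ) => fderiv ℝ D (thicken ψ p.1)) ℱ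
      (𝓝 (fderiv ℝ D (ψ q))) :=
    (h.contDiffAt_fun.fderiv_right (m := 2) (by norm_num)).continuousAt.tendsto.comp hD0
  have hD2 : Tendsto (fun p : ((ℂ × ℝ) × ℝ) × (ℂ × ℂ) => fderiv ℝ (fderiv ℝ D) (thicken ψ p.1)) ℱ
      (𝓝 (fderiv ℝ (fderiv ℝ D) (ψ q))) :=
    ((h.contDiffAt_fun.fderiv_right (m := 2) (by norm_num)).fderiv_right (m := 1)
      (by norm_num)).continuousAt.tendsto.comp hD0
  have happ : ∀ {f g : ((ℂ × ℝ) × ℝ) × (ℂ × ℂ) → F} {v w : F}, Tendsto f ℱ (𝓝 v) →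
      Tendsto g ℱ (𝓝 w) → Tendsto (fun p => fderiv ℝ (fderiv ℝ D) (thicken ψ p.1) (f p) (g p)) ℱ
        (𝓝 (fderiv ℝ (fderiv ℝ D) (ψ q) v w)) :=
    fun hf hg => tendsto_clm_apply (tendsto_clm_apply hD2 hf) hg
  have hmix : Tendsto (fun p : ((ℂ × ℝ) × ℝ) × (ℂ × ℂ) => leviMixed D (thicken ψ p.1)
      (p.2.1 • thickenLeaf ψ p.1) (p.2.2 • transVec ψ p.1.1)) ℱ
      (𝓝 (leviMixed D (ψ q) (b₀ • leafVec ψ q) (a₀ • transVec ψ q))) :=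
    ((((happ hbT haN).add (happ haN hbT)).add
      (happ (hbT.const_smul Complex.I) (haN.const_smul Complex.I))).add
      (happ (haN.const_smul Complex.I) (hbT.const_smul Complex.I))).div_const 4
  have hlev : Tendsto (fun p : ((ℂ × ℝ) × ℝ) × (ℂ × ℂ) => flatLevi D (thicken ψ p.1)
      (p.2.2 • transVec ψ p.1.1)) ℱ (𝓝 (flatLevi D (ψ q) (a₀ • transVec ψ q))) :=
    ((happ haN haN).add
      (happ (haN.const_smul Complex.I) (haN.const_smul Complex.I))).div_const 4
  have k0 := h.tendsto_fun_div.comp hfst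
  have k1 := (h.tendsto_fderiv_div 1).comp hfst
  have k2 := (h.tendsto_fderiv_div Complex.I).comp hfst
  have k3 := h.tendsto_flatLevi_div.comp hfst
  have hlim := (k0.neg.mul ((((((hre hb).pow 2).add ((him hb).pow 2)).mul k3).add hmix).add
      (hs.mul hlev))).add
    ((tendsto_const_nhds (x := c)).mul
      ((((((hre hb).mul k1).add ((him hb).mul k2)).add (tendsto_clm_apply hD1 haN)).pow 2).add
      (((((hre hb).mul k2).sub ((him hb).mul k1)).add
        (tendsto_clm_apply hD1 (haN.const_smul Complex.I))).pow 2))|>.div_const 4)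
  have hval : chartModelForm D ψ q c b₀ a₀ = -conormal D ψ q *
      ((b₀.re ^ 2 + b₀.im ^ 2) * flatLevi (leafConormal D ψ q.2) q.1 1
        + leviMixed D (ψ q) (b₀ • leafVec ψ q) (a₀ • transVec ψ q)
        + 0 * flatLevi D (ψ q) (a₀ • transVec ψ q))
      + c * ((b₀.re * fderiv ℝ (leafConormal D ψ q.2) q.1 1
          + b₀.im * fderiv ℝ (leafConormal D ψ q.2) q.1 Complex.I
          + fderiv ℝ D (ψ q) (a₀ • transVec ψ q)) ^ 2
        + (b₀.re * fderiv ℝ (leafConormal D ψ q.2) q.1 Complex.I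
          - b₀.im * fderiv ℝ (leafConormal D ψ q.2) q.1 1
          + fderiv ℝ D (ψ q) (Complex.I • a₀ • transVec ψ q)) ^ 2) / 4 := by
    have e1 : fderiv ℝ D (ψ q) (a₀ • transVec ψ q) = a₀.im * conormal D ψ q := by
      rw [complex_smul_eq a₀]
      simp only [map_add, map_smul, h.conormal_eq, smul_eq_mul, conormal]
      ring
    have e2 : fderiv ℝ D (ψ q) (Complex.I • a₀ • transVec ψ q) = a₀.re * conormal D ψ q := by
      rw [I_smul_complex_smul]
      simp only [map_sub, map_smul, h.conormal_eq, smul_eq_mul, conormal]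
      ring
    rw [leviMixed_complex_smul D (h.contDiffAt_fun.of_le (by norm_num)), h.levi_mixed.1,
      h.levi_mixed.2, e1, e2, chartModelForm, modelForm]
    ring
  rw [hval]
  refine hlim.congr' ?_
  filter_upwards [self_mem_nhdsWithin] with p hp
  exact (exponentForm_expand D c _ _ _ _ _ hp).symm

/-- Since s = 0 parametrizes the hypersurface, leaving the zero set forces s ≠ 0. Only this is used,
so the sign of s on the side of Ω never matters. -/
theorem eventually_ne_zero (h : IsFlatChart D ψ q) :
    ∀ᶠ y in 𝓝 (q, (0 : ℝ)), D (thicken ψ y) ≠ 0 → y.2 ≠ 0 := by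
  filter_upwards [(continuous_fst.tendsto (q, (0 : ℝ))).eventually h.vanish] with y hy hD h0
  apply hD
  rw [show y = (y.1, 0) from Prod.ext rfl h0]
  simpa using hy

theorem eventually_linearIndependent (h : IsFlatChart D ψ q) :
    ∀ᶠ y in 𝓝 (q, (0 : ℝ)), LinearIndependent ℂ ![thickenLeaf ψ y, transVec ψ y.1] := by
  have h1 : ContinuousAt (fun y : (ℂ × ℝ) × ℝ => ![thickenLeaf ψ y, transVec ψ y.1]) (q, 0) := by
    refine continuousAt_pi.2 fun i => ?_
    fin_cases i
    · exact (contDiffAt_thickenLeaf h.contDiffAt_param 0).continuousAt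
    · exact (contDiffAt_transVec h.contDiffAt_param).continuousAt.comp
        (f := fun y : (ℂ × ℝ) × ℝ => y.1) (x := (q, 0)) continuousAt_fst
  exact h1.eventually (LinearIndependent.eventually (by simpa using h.linearIndependent))

/-- A sufficient condition for the positivity of `exponentForm` near the boundary. -/
theorem eventually_exponentForm_pos (hF : Module.finrank ℂ F = 2) (h : IsFlatChart D ψ q) {c : ℝ}
    (hpos : ∀ b a : ℂ, (b, a) ≠ 0 → 0 < chartModelForm D ψ q c b a) :
    ∀ᶠ x in 𝓝 (ψ q), D x ≠ 0 → ∀ v : F, v ≠ 0 → 0 < exponentForm D c x v := by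
  rw [← h.map_thicken_nhds hF, eventually_map]
  have h1 : ∀ᶠ y in 𝓝 (q, (0 : ℝ)), ∀ k ∈ Metric.sphere (0 : ℂ × ℂ) 1, y.2 ≠ 0 →
      0 < exponentForm D c (thicken ψ y) (k.1 • thickenLeaf ψ y
          + y.2 • (k.2 • transVec ψ y.1)) / y.2 ^ 2 := by
    refine (isCompact_sphere (0 : ℂ × ℂ) 1).eventually_forall_of_forall_eventually ?_
    rintro ⟨b, a⟩ hba
    have hne : (b, a) ≠ (0 : ℂ × ℂ) := by
      rintro h0
      rw [h0] at hba
      simp at hba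
    have := (h.tendsto_exponentForm c b a).eventually (lt_mem_nhds (hpos b a hne))
    rw [eventually_nhdsWithin_iff] at this
    exact this
  filter_upwards [h1, h.eventually_ne_zero, h.eventually_linearIndependent] with y hy hs hli hD v hv
  have hs := hs hD
  obtain ⟨b, a, rfl⟩ := exists_combination hF hli v
  -- Dividing the normal coefficient by s absorbs the weight; quadratic homogeneity then reduces to
  -- the unit sphere.
  set k : ℂ × ℂ := (b, y.2⁻¹ • a) with hk
  have hk0 : k ≠ 0 := by
    intro h0
    have e1 : b = 0 := congrArg Prod.fst h0
    have e2 : y.2⁻¹ • a = 0 := congrArg Prod.snd h0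
    have e3 : a = 0 := by simpa [hs] using e2
    exact hv (by simp [e1, e3])
  have hn : 0 < ‖k‖ := norm_pos_iff.2 hk0
  have h2 := hy (‖k‖⁻¹ • k) (by simp [norm_smul, hn.ne']) hs
  have h3 : (‖k‖⁻¹ • k).1 • thickenLeaf ψ y + y.2 • ((‖k‖⁻¹ • k).2 • transVec ψ y.1)
      = ‖k‖⁻¹ • (b • thickenLeaf ψ y + a • transVec ψ y.1) := by
    have e : y.2 • y.2⁻¹ • a = a := by rw [smul_smul, mul_inv_cancel₀ hs, one_smul]
    rw [Prod.smul_fst, Prod.smul_snd, smul_assoc, smul_assoc, smul_add, smul_comm y.2,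
      ← smul_assoc y.2, e]
  rw [h3, exponentForm_smul] at h2
  have h4 := (div_pos_iff_of_pos_right (by positivity)).1 h2
  exact pos_of_mul_pos_right h4 (by positivity)

/-- A lower bound for `exponentForm` passes to the limit at the boundary. -/
theorem le_chartModelForm (h : IsFlatChart D ψ q) (c : ℝ) (a : ℂ) {G : (ℂ × ℝ) × ℝ → ℝ}
    (hG : ContinuousAt G (q, 0))
    (hle : ∃ᶠ y in 𝓝 (q, (0 : ℝ)), D (thicken ψ y) ≠ 0 ∧ D (thicken ψ y) ^ 2 * G y
      ≤ exponentForm D c (thicken ψ y) (thickenLeaf ψ y + y.2 • (a • transVec ψ y.1))) :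
    conormal D ψ q ^ 2 * G (q, 0) ≤ chartModelForm D ψ q c 1 a := by
  have h1 : ∃ᶠ y in 𝓝[{y | y.2 ≠ 0}] (q, (0 : ℝ)), (D (thicken ψ y) / y.2) ^ 2 * G y
      ≤ exponentForm D c (thicken ψ y)
        ((1 : ℂ) • thickenLeaf ψ y + y.2 • (a • transVec ψ y.1)) / y.2 ^ 2 := by
    rw [frequently_nhdsWithin_iff]
    refine (hle.and_eventually h.eventually_ne_zero).mono ?_
    rintro y ⟨⟨hD, hy⟩, hs⟩
    have hs := hs hD
    refine ⟨?_, hs⟩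
    rw [one_smul, div_pow, div_mul_eq_mul_div]
    exact div_le_div_of_nonneg_right hy (by positivity)
  have hι : Tendsto (fun y : (ℂ × ℝ) × ℝ => (y, ((1 : ℂ), a))) (𝓝[{y | y.2 ≠ 0}] (q, (0 : ℝ)))
      (𝓝[{p | p.1.2 ≠ 0}] ((q, 0), (1, a))) := by
    refine tendsto_nhdsWithin_iff.2 ⟨?_, self_mem_nhdsWithin⟩
    have : Continuous (fun y : (ℂ × ℝ) × ℝ => (y, ((1 : ℂ), a))) := by fun_prop
    exact (this.tendsto (q, 0)).mono_left nhdsWithin_le_nhds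
  have h2 := (h.tendsto_exponentForm c 1 a).comp hι
  have h3 := (h.tendsto_fun_div.pow 2).mul (hG.tendsto.mono_left
    (nhdsWithin_le_nhds (s := {y : (ℂ × ℝ) × ℝ | y.2 ≠ 0})))
  exact le_of_tendsto_of_tendsto_of_frequently h3 h2 h1

end IsFlatChart

/-! ### Transfer to a fixed holomorphic chart -/


section Chart

variable {E : Type*} [TopologicalSpace E] {X : Type*} [TopologicalSpace X] [ChartedSpace E X]

theorem chart_mem_transition {p x : X} (hx : x ∈ (chartAt E p).source) :
    chartAt E x x ∈ ((chartAt E x).symm ≫ₕ chartAt E p).source := by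
  simp [hx]

theorem transition_apply (p x : X) :
    (chartAt E p ∘ (chartAt E x).symm) (chartAt E x x) = chartAt E p x := by
  simp

theorem eventually_comp_transition {G : Type*} (f : X → G) {p x : X}
    (hx : x ∈ (chartAt E p).source) :
    f ∘ (chartAt E x).symm =ᶠ[𝓝 (chartAt E x x)]
      (f ∘ (chartAt E p).symm) ∘ (chartAt E p ∘ (chartAt E x).symm) := by
  filter_upwards [((chartAt E x).symm ≫ₕ chartAt E p).open_source.mem_nhds
    (chart_mem_transition hx)] with u hu
  rw [OpenPartialHomeomorph.trans_source] at hu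
  simp [(chartAt E p).left_inv hu.2]

end Chart

section Transfer

variable {E : Type*} [NormedAddCommGroup E] [NormedSpace ℂ E]
  {X : Type*} [TopologicalSpace X] [ChartedSpace E X]

theorem contDiffAt_transition [IsManifold 𝓘(ℂ, E) ω X] {e e' : OpenPartialHomeomorph X E}
    (he : e ∈ atlas E X) (he' : e' ∈ atlas E X) {u : E} (hu : u ∈ (e.symm ≫ₕ e').source) :
    ContDiffAt ℂ ω (e' ∘ e.symm) u := by
  have h := (HasGroupoid.compatible (G := contDiffGroupoid ω 𝓘(ℂ, E)) he he').1
  have h0 : ContDiffOn ℂ ω (𝓘(ℂ, E) ∘ (e.symm ≫ₕ e') ∘ 𝓘(ℂ, E).symm)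
      (𝓘(ℂ, E).symm ⁻¹' (e.symm ≫ₕ e').source ∩ Set.range 𝓘(ℂ, E)) := h
  have h' : ContDiffOn ℂ ω (e' ∘ e.symm) (e.symm ≫ₕ e').source := by
    simpa using! h0
  exact h'.contDiffAt ((e.symm ≫ₕ e').open_source.mem_nhds hu)

theorem isManifold_real_of_complex [IsManifold 𝓘(ℂ, E) ω X] : IsManifold 𝓘(ℝ, E) 3 X := by
  refine isManifold_of_contDiffOn 𝓘(ℝ, E) 3 X ?_
  intro e e' he he' u hu
  have hu' : u ∈ (e.symm ≫ₕ e').source := by simpa using! hu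
  exact (((contDiffAt_transition he he' hu').restrict_scalars ℝ).of_le le_top).contDiffWithinAt

/-- The derivative of the change of coordinates from the preferred chart at `x` to the preferred
chart at `p`. -/
noncomputable def chartDeriv (p x : X) : E →L[ℝ] E :=
  fderiv ℝ (chartAt E p ∘ (chartAt E x).symm) (chartAt E x x)

/-- Continuity of a hermitian metric along a continuous family of vectors. -/
theorem continuousAt_metric [IsManifold 𝓘(ℝ, E) 1 X]
    (g : Bundle.ContinuousRiemannianMetric E (fun x : X => TangentSpace 𝓘(ℝ, E) x))
    {Y : Type*} [TopologicalSpace Y] {b : Y → X} {v : Y → E} {w : Y → E} {y₀ : Y} {p : X}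
    (hp : b y₀ = p) (hb : ContinuousAt b y₀) (hw : ContinuousAt w y₀)
    (hv : ∀ᶠ y in 𝓝 y₀, chartDeriv p (b y) (v y) = w y) :
    ContinuousAt (fun y => g.inner (b y) (v y : E) (v y : E)) y₀ := by
  subst hp
  have hs : ContinuousAt (fun y => (⟨b y, v y⟩ : TangentBundle 𝓘(ℝ, E) X)) y₀ := by
    rw [FiberBundle.continuousAt_totalSpace]
    refine ⟨hb, hw.congr ?_⟩
    filter_upwards [hv] with y hy
    rw [← hy, TangentBundle.trivializationAt_apply]
    simp [chartDeriv]
  have hg : ContinuousAt (fun y => (⟨b y, g.inner (b y)⟩ : Bundle.TotalSpace (E →L[ℝ] E →L[ℝ] ℝ)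
      (fun x : X => TangentSpace 𝓘(ℝ, E) x →L[ℝ] TangentSpace 𝓘(ℝ, E) x →L[ℝ] ℝ))) y₀ :=
    g.continuous.continuousAt.comp hb
  have := hg.clm_bundle_apply₂ (F₁ := E) (F₂ := E) (E₃ := Bundle.Trivial X ℝ) hs hs
  rw [FiberBundle.continuousAt_totalSpace] at this
  exact this.2

variable [IsManifold 𝓘(ℂ, E) ω X]

theorem chartDeriv_smul {p x : X} (hx : x ∈ (chartAt E p).source) (c : ℂ) (v : E) :
    chartDeriv p x (c • v) = c • chartDeriv p x v :=
  fderiv_real_smul ((contDiffAt_transition (chart_mem_atlas E x) (chart_mem_atlas E p)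
    (chart_mem_transition hx)).differentiableAt (by simp)) c v

/-- The preferred chart changes with x. Holomorphy of the transition maps allows one chart at p to
serve all nearby points. -/
theorem leviForm_eq_flatLevi {f : X → ℝ} {p x : X} (hx : x ∈ (chartAt E p).source)
    (hf : ContDiffAt ℝ 2 (f ∘ (chartAt E p).symm) (chartAt E p x)) (v : E) :
    leviForm f x v = flatLevi (f ∘ (chartAt E p).symm) (chartAt E p x) (chartDeriv p x v) := by
  have h1 : leviForm f x v = flatLevi (f ∘ (chartAt E x).symm) (chartAt E x x) v := rfl
  have ht := contDiffAt_transition (chart_mem_atlas E x) (chart_mem_atlas E p)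
    (chart_mem_transition hx)
  have hol : ∀ᶠ u in 𝓝 (chartAt E x x),
      DifferentiableAt ℂ (chartAt E p ∘ (chartAt E x).symm) u := by
    filter_upwards [((chartAt E x).symm ≫ₕ chartAt E p).open_source.mem_nhds
      (chart_mem_transition hx)] with u hu
    exact (contDiffAt_transition (chart_mem_atlas E x) (chart_mem_atlas E p)
      hu).differentiableAt (by simp)
  have h2 := flatLevi_comp_holomorphic (f := f ∘ (chartAt E p).symm) (x := chartAt E x x)
    (Ψ := chartAt E p ∘ (chartAt E x).symm) (by rwa [transition_apply])
    ((ht.restrict_scalars ℝ).of_le le_top) hol v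
  rw [h1, flatLevi_congr (eventually_comp_transition f hx), h2, transition_apply]
  rfl

theorem mfderiv_chart {p x : X} (hx : x ∈ (chartAt E p).source) (v : E) :
    mfderiv 𝓘(ℝ, E) 𝓘(ℝ, E) (chartAt E p) x v = chartDeriv p x v := by
  have : IsManifold 𝓘(ℝ, E) 1 X := isManifold_real
  have h := mdifferentiableAt_atlas (I := 𝓘(ℝ, E)) (chart_mem_atlas E p) hx
  rw [h.mfderiv]
  simp [writtenInExtChartAt, chartDeriv, fderivWithin_univ, extChartAt]
  rfl

theorem contDiffAt_of_contMDiffAt {f : X → ℝ} {p x : X} (hx : x ∈ (chartAt E p).source)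
    (hf : ContMDiffAt 𝓘(ℝ, E) 𝓘(ℝ, ℝ) 3 f x) :
    ContDiffAt ℝ 3 (f ∘ (chartAt E p).symm) (chartAt E p x) := by
  have : IsManifold 𝓘(ℝ, E) 3 X := isManifold_real_of_complex
  rw [← contMDiffAt_iff_contDiffAt]
  have h1 : ContMDiffAt 𝓘(ℝ, E) 𝓘(ℝ, E) 3 (chartAt E p).symm (chartAt E p x) :=
    contMDiffOn_chart_symm.contMDiffAt
      ((chartAt E p).open_target.mem_nhds ((chartAt E p).map_source hx))
  refine ContMDiffAt.comp (chartAt E p x) ?_ h1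
  rwa [(chartAt E p).left_inv hx]

theorem diff_eq_fderiv {f : X → ℝ} {p x : X} (hx : x ∈ (chartAt E p).source)
    (hf : ContMDiffAt 𝓘(ℝ, E) 𝓘(ℝ, ℝ) 3 f x) (v : E) :
    diff f x v = fderiv ℝ (f ∘ (chartAt E p).symm) (chartAt E p x) (chartDeriv p x v) := by
  have : IsManifold 𝓘(ℝ, E) 1 X := isManifold_real
  have h1 : f =ᶠ[𝓝 x] (f ∘ (chartAt E p).symm) ∘ chartAt E p := by
    filter_upwards [(chartAt E p).open_source.mem_nhds hx] with y hy
    simp [(chartAt E p).left_inv hy]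
  have h2 : MDifferentiableAt 𝓘(ℝ, E) 𝓘(ℝ, ℝ) (f ∘ (chartAt E p).symm) (chartAt E p x) :=
    mdifferentiableAt_iff_differentiableAt.2
      ((contDiffAt_of_contMDiffAt hx hf).differentiableAt (by norm_num))
  have h3 := mdifferentiableAt_atlas (I := 𝓘(ℝ, E)) (chart_mem_atlas E p) hx
  rw [diff, h1.mfderiv_eq]
  have h4 := mfderiv_comp_apply x h2 h3 v
  rw [mfderiv_chart hx, mfderiv_eq_fderiv] at h4
  exact h4

theorem chartDeriv_mfderiv {φ : ℂ × ℝ → X} {p : X} {y : ℂ × ℝ}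
    (hφ : MDifferentiableAt 𝓘(ℝ, ℂ × ℝ) 𝓘(ℝ, E) φ y) (hy : φ y ∈ (chartAt E p).source)
    (w : ℂ × ℝ) :
    chartDeriv (E := E) p (φ y) (mfderiv 𝓘(ℝ, ℂ × ℝ) 𝓘(ℝ, E) φ y w)
      = fderiv ℝ (chartAt E p ∘ φ) y w := by
  have : IsManifold 𝓘(ℝ, E) 1 X := isManifold_real
  have h3 := mdifferentiableAt_atlas (I := 𝓘(ℝ, E)) (chart_mem_atlas E p) hy
  have h4 := mfderiv_comp_apply y h3 hφ w
  rw [mfderiv_eq_fderiv] at h4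
  exact ((mfderiv_chart hy _).symm.trans h4.symm)

theorem chartDeriv_bijective {p x : X} (hx : x ∈ (chartAt E p).source) :
    Function.Bijective (chartDeriv (E := E) p x) := by
  have : IsManifold 𝓘(ℝ, E) 1 X := isManifold_real
  have h := (mdifferentiable_chart (I := 𝓘(ℝ, E)) p).mfderiv_bijective hx
  have h2 : (chartDeriv p x : E → E) = mfderiv 𝓘(ℝ, E) 𝓘(ℝ, E) (chartAt E p) x :=
    funext fun v => (mfderiv_chart hx v).symm
  rw [h2]
  exact h

end Transfer

/-! ### Curvature of the normal metric -/

section Leafwise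

theorem flatLevi_neg {F : Type*} [NormedAddCommGroup F] [NormedSpace ℂ F] (f : F → ℝ) (x v : F) :
    flatLevi (fun y => -f y) x v = -flatLevi f x v := by
  have h : fderiv ℝ (fun y => -f y) = fun y => -fderiv ℝ f y := by
    ext1 y; exact fderiv_fun_neg
  simp only [flatLevi, h, fderiv_fun_neg, _root_.neg_apply]
  ring

theorem fderiv_ofReal_comp {ℓ : ℂ → ℝ} {z : ℂ} (hℓ : DifferentiableAt ℝ ℓ z) (w : ℂ) :
    fderiv ℝ (fun u => (ℓ u : ℂ)) z w = (fderiv ℝ ℓ z w : ℂ) := by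
  have := (Complex.ofRealCLM.hasFDerivAt (x := ℓ z)).comp z hℓ.hasFDerivAt
  rw [HasFDerivAt.fderiv (f := fun u => (ℓ u : ℂ)) this]
  simp

variable {F : ℂ × ℝ → ℂ} {q : ℂ × ℝ} {ℓ : ℂ → ℝ}

theorem leafDz_eq (hℓ : DifferentiableAt ℝ ℓ q.1)
    (h : (fun z => F (z, q.2)) =ᶠ[𝓝 q.1] fun z => (ℓ z : ℂ)) :
    leafDz F q = (fderiv ℝ ℓ q.1 1 - Complex.I * fderiv ℝ ℓ q.1 Complex.I) / 2 := by
  rw [leafDz, h.fderiv_eq, fderiv_ofReal_comp hℓ, fderiv_ofReal_comp hℓ]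

theorem leafDzbar_eq (hℓ : DifferentiableAt ℝ ℓ q.1)
    (h : (fun z => F (z, q.2)) =ᶠ[𝓝 q.1] fun z => (ℓ z : ℂ)) :
    leafDzbar F q = (fderiv ℝ ℓ q.1 1 + Complex.I * fderiv ℝ ℓ q.1 Complex.I) / 2 := by
  rw [leafDzbar, h.fderiv_eq, fderiv_ofReal_comp hℓ, fderiv_ofReal_comp hℓ]

theorem leafDz_mul_leafDzbar (hℓ : DifferentiableAt ℝ ℓ q.1)
    (h : (fun z => F (z, q.2)) =ᶠ[𝓝 q.1] fun z => (ℓ z : ℂ)) :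
    leafDz F q * leafDzbar F q = (normSqPartial ℓ q.1 1 : ℂ) := by
  rw [leafDz_eq hℓ h, leafDzbar_eq hℓ h, normSqPartial]
  simp only [smul_eq_mul, mul_one]
  push_cast
  linear_combination (-(fderiv ℝ ℓ q.1 Complex.I : ℂ) ^ 2 / 4) * Complex.I_sq

/-- In one complex variable both sides are a quarter of the Laplacian; the mixed second derivatives
cancel by symmetry. -/
theorem leafDz_leafDzbar (hℓ : ContDiffAt ℝ 2 ℓ q.1)
    (h : (fun z => F (z, q.2)) =ᶠ[𝓝 q.1] fun z => (ℓ z : ℂ)) :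
    leafDz (leafDzbar F) q = (flatLevi ℓ q.1 1 : ℂ) := by
  have h1 : (fun z => leafDzbar F (z, q.2)) =ᶠ[𝓝 q.1]
      fun z => (fderiv ℝ ℓ z 1 + Complex.I * fderiv ℝ ℓ z Complex.I : ℂ) / 2 := by
    filter_upwards [h.eventually_nhds, eventually_differentiableAt (n := 2) hℓ (by norm_num)]
      with z hz hd
    exact leafDzbar_eq (q := (z, q.2)) hd hz
  have hc : ∀ v : ℂ, HasFDerivAt (fun z => ((fderiv ℝ ℓ z v : ℝ) : ℂ))
      (Complex.ofRealCLM.comp ((fderiv ℝ (fderiv ℝ ℓ) q.1).flip v)) q.1 := by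
    intro v
    have h2 := (differentiableAt_fderiv hℓ).hasFDerivAt.clm_apply (hasFDerivAt_const v q.1)
    have h3 := (Complex.ofRealCLM.hasFDerivAt (x := fderiv ℝ ℓ q.1 v)).comp q.1 h2
    refine h3.congr_fderiv ?_
    ext w
    simp
  have h4 := ((hc 1).add ((hc Complex.I).const_mul Complex.I)).mul_const ((2 : ℂ)⁻¹)
  have h5 : HasFDerivAt
      (fun z => (fderiv ℝ ℓ z 1 + Complex.I * fderiv ℝ ℓ z Complex.I : ℂ) / 2) _ q.1 := h4
  rw [leafDz, h1.fderiv_eq, h5.fderiv, flatLevi]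
  have hsym := fderiv_fderiv_symm hℓ 1 Complex.I
  simp [hsym]
  linear_combination (-(fderiv ℝ (fderiv ℝ ℓ) q.1 Complex.I Complex.I : ℂ) / 4) * Complex.I_sq

end Leafwise

/-- `Θ H²`, where `H` is the transverse derivative of `D`. -/
noncomputable def curvatureForm {F : Type*} [NormedAddCommGroup F] [NormedSpace ℂ F] (D : F → ℝ)
    (ψ : ℂ × ℝ → F) (q : ℂ × ℝ) : ℝ :=
  exponentForm (leafConormal D ψ q.2) 1 q.1 1

/-- `A H²`, where `H` is the transverse derivative of `D`. -/
noncomputable def gradientForm {F : Type*} [NormedAddCommGroup F] [NormedSpace ℂ F] (D : F → ℝ)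
    (ψ : ℂ × ℝ → F) (q : ℂ × ℝ) : ℝ :=
  normSqPartial (leafConormal D ψ q.2) q.1 1

theorem gradientForm_nonneg {F : Type*} [NormedAddCommGroup F] [NormedSpace ℂ F] (D : F → ℝ)
    (ψ : ℂ × ℝ → F) (q : ℂ × ℝ) : 0 ≤ gradientForm D ψ q := by
  rw [gradientForm, normSqPartial]
  positivity

namespace IsFlatChart

variable {F : Type*} [NormedAddCommGroup F] [NormedSpace ℂ F]
variable {D : F → ℝ} {ψ : ℂ × ℝ → F} {q : ℂ × ℝ}

theorem curvature_eq (hF : Module.finrank ℂ F = 2) (h : IsFlatChart D ψ q) {m : ℂ × ℝ → ℝ}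
    (hm : ∀ᶠ y in 𝓝 q, m y = |conormal D ψ y|) :
    chernCurvature m q = ((curvatureForm D ψ q / conormal D ψ q ^ 2 : ℝ) : ℂ) ∧
      formA m q = ((gradientForm D ψ q / conormal D ψ q ^ 2 : ℝ) : ℂ) := by
  have hne : leafConormal D ψ q.2 q.1 ≠ 0 := h.conormal_ne_zero hF
  have hK := h.contDiffAt_leafConormal
  have hℓ : ContDiffAt ℝ 2 (fun z => Real.log (leafConormal D ψ q.2 z)) q.1 := hK.log hne
  have hm' : (fun z : ℂ => ((Real.log (m (z, q.2)) : ℝ) : ℂ)) =ᶠ[𝓝 q.1]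
      fun z => ((Real.log (leafConormal D ψ q.2 z) : ℝ) : ℂ) := by
    filter_upwards [(tendsto_slice q).eventually hm] with z hz
    -- `Real.log` ignores the sign of its argument, so the sign of H need not be determined.
    rw [hz, Real.log_abs, leafConormal]
  constructor
  · rw [chernCurvature, leafDz_leafDzbar (F := fun y => ((Real.log (m y) : ℝ) : ℂ)) hℓ hm',
      ← Complex.ofReal_neg, ← flatLevi_neg, flatLevi_neg_log hK hne]
    rfl
  · rw [formA, leafDz_mul_leafDzbar (F := fun y => ((Real.log (m y) : ℝ) : ℂ))
      (hℓ.differentiableAt (by norm_num)) hm',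
      normSqPartial_log (hK.differentiableAt (by norm_num)) hne]
    rfl

theorem chartModelForm_pos (hF : Module.finrank ℂ F = 2) (h : IsFlatChart D ψ q) {c : ℝ}
    (hc : 0 < c) (hlt : gradientForm D ψ q < c * (curvatureForm D ψ q + gradientForm D ψ q))
    {b a : ℂ} (hba : (b, a) ≠ 0) : 0 < chartModelForm D ψ q c b a := by
  refine modelForm_pos (h.conormal_ne_zero hF) hc ?_ hba
  simp only [gradientForm, curvatureForm, exponentForm, normSqPartial, smul_eq_mul, mul_one,
    leafConormal] at hlt
  convert hlt using 2
  simp only [Prod.mk.eta]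
  ring

theorem exists_chartModelForm_eq (hF : Module.finrank ℂ F = 2) (h : IsFlatChart D ψ q) {c : ℝ}
    (hc : 0 < c) : ∃ a : ℂ, c * chartModelForm D ψ q c 1 a
      = c * (curvatureForm D ψ q + gradientForm D ψ q) - gradientForm D ψ q := by
  obtain ⟨a, ha⟩ := exists_modelForm_eq (H := conormal D ψ q)
    (L := flatLevi (leafConormal D ψ q.2) q.1 1)
    (K₁ := fderiv ℝ (leafConormal D ψ q.2) q.1 1)
    (K₂ := fderiv ℝ (leafConormal D ψ q.2) q.1 Complex.I) (h.conormal_ne_zero hF) hc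
  refine ⟨a, ha.trans ?_⟩
  simp only [gradientForm, curvatureForm, exponentForm, normSqPartial, smul_eq_mul, mul_one]
  have : leafConormal D ψ q.2 q.1 = conormal D ψ q := rfl
  rw [this]
  ring

end IsFlatChart

/-! ### Foliated charts of the boundary -/

section Boundary

variable {E : Type*} [NormedAddCommGroup E] [NormedSpace ℂ E]
  {X : Type*} [TopologicalSpace X] [ChartedSpace E X]
  {Ω : Set X} {δ : X → ℝ}

theorem IsBoundaryDistance.eventually_contMDiffAt (hδ : IsBoundaryDistance E Ω δ) {p : X}
    (hp : p ∈ frontier Ω) : ∀ᶠ x in 𝓝 p, ContMDiffAt 𝓘(ℝ, E) 𝓘(ℝ, ℝ) 3 δ x := by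
  obtain ⟨W, hW, hΩW, hc⟩ := hδ.contMDiffOn
  filter_upwards [hW.mem_nhds (hΩW (frontier_subset_closure hp))] with x hx
  exact hc.contMDiffAt (hW.mem_nhds hx)

/-- A boundary point lies outside the open set Ω, which excludes δ > 0, and is a limit of points of
Ω, which gives δ ≥ 0. -/
theorem IsBoundaryDistance.eq_zero (hδ : IsBoundaryDistance E Ω δ) (hΩ : IsOpen Ω) {p : X}
    (hp : p ∈ frontier Ω) : δ p = 0 := by
  have hcl : p ∈ closure Ω := frontier_subset_closure hp
  have hnot : p ∉ Ω := fun h => (hΩ.frontier_eq ▸ hp).2 h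
  refine le_antisymm (not_lt.1 fun h => hnot ((hδ.pos_iff p hcl).2 h)) ?_
  refine ge_of_tendsto_of_frequently
    (hδ.eventually_contMDiffAt hp).self_of_nhds.continuousAt.tendsto ?_
  refine (mem_closure_iff_frequently.1 hcl).mono fun x hx => ?_
  exact ((hδ.pos_iff x (subset_closure hx)).1 hx).le

variable {V : Set (ℂ × ℝ)} {φ : ℂ × ℝ → X} {q : ℂ × ℝ}

theorem IsFoliatedChart.mem {M : Set X} (hφ : IsFoliatedChart E M V φ) {y : ℂ × ℝ} (hy : y ∈ V) :
    φ y ∈ M := by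
  obtain ⟨O, _, hO⟩ := hφ.image_eq
  exact (hO ▸ Set.mem_image_of_mem φ hy).2

theorem IsFoliatedChart.eventually_mem {M : Set X} (hφ : IsFoliatedChart E M V φ) (hq : q ∈ V) :
    ∀ᶠ y in 𝓝 q, y ∈ V ∧ φ y ∈ (chartAt E (φ q)).source := by
  have hc : ContinuousAt φ q := (hφ.contMDiffOn.contMDiffAt (hφ.isOpen.mem_nhds hq)).continuousAt
  have h1 : ∀ᶠ y in 𝓝 q, y ∈ V := hφ.isOpen.mem_nhds hq
  exact h1.and (hc.eventually ((chartAt E (φ q)).open_source.mem_nhds (mem_chart_source E (φ q))))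

/-- The parametrization of a neighbourhood of a boundary point induced by a foliated chart. -/
noncomputable def collar (E : Type*) [NormedAddCommGroup E] [NormedSpace ℂ E]
    {X : Type*} [TopologicalSpace X] [ChartedSpace E X] (φ : ℂ × ℝ → X) (q : ℂ × ℝ)
    (y : (ℂ × ℝ) × ℝ) : X :=
  (chartAt E (φ q)).symm (thicken (chartAt E (φ q) ∘ φ) y)

theorem collar_apply_zero : collar E φ q (q, 0) = φ q := by
  simp [collar]

theorem map_collar (hE : Module.finrank ℂ E = 2)
    (h : IsFlatChart (δ ∘ (chartAt E (φ q)).symm) (chartAt E (φ q) ∘ φ) q) :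
    map (collar E φ q) (𝓝 (q, 0)) = 𝓝 (φ q) := by
  have hp : φ q ∈ (chartAt E (φ q)).source := mem_chart_source E (φ q)
  have h1 := h.map_thicken_nhds hE
  have h2 := (chartAt E (φ q)).symm.map_nhds_eq ((chartAt E (φ q)).map_source hp)
  rw [(chartAt E (φ q)).left_inv hp] at h2
  change map ((chartAt E (φ q)).symm ∘ thicken (chartAt E (φ q) ∘ φ)) _ = _
  rw [← Filter.map_map, h1]
  exact h2

variable [IsManifold 𝓘(ℂ, E) ω X]

/-- A foliated chart of the boundary, in the preferred chart of the manifold. -/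
theorem isFlatChart (hΩ : IsOpen Ω) (hδ : IsBoundaryDistance E Ω δ)
    (hφ : IsFoliatedChart E (frontier Ω) V φ) (hq : q ∈ V) :
    IsFlatChart (δ ∘ (chartAt E (φ q)).symm) (chartAt E (φ q) ∘ φ) q := by
  have : IsManifold 𝓘(ℝ, E) 3 X := isManifold_real_of_complex
  have : IsManifold 𝓘(ℂ, E) 1 X := IsManifold.of_le (n := ω) le_top
  set e := chartAt E (φ q) with he
  have hp : φ q ∈ e.source := mem_chart_source E (φ q)
  have hδp := (hδ.eventually_contMDiffAt (hφ.mem hq)).self_of_nhds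
  have hφq := hφ.contMDiffOn.contMDiffAt (hφ.isOpen.mem_nhds hq)
  refine ⟨contDiffAt_of_contMDiffAt hp hδp, ?_, ?_, ?_, ?_, ?_⟩
  · rw [← contMDiffAt_iff_contDiffAt]
    exact ContMDiffAt.comp q (contMDiffOn_chart.contMDiffAt (e.open_source.mem_nhds hp)) hφq
  · filter_upwards [hφ.eventually_mem hq] with y hy
    have hopen : IsOpen {z : ℂ | (z, y.2) ∈ V} :=
      hφ.isOpen.preimage (by fun_prop : Continuous fun z : ℂ => ((z, y.2) : ℂ × ℝ))
    have h1 := (hφ.holomorphic y.2).mdifferentiableAt (hopen.mem_nhds (x := y.1) hy.1)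
    have h2 := mdifferentiableAt_atlas (I := 𝓘(ℂ, E)) (chart_mem_atlas E (φ q)) hy.2
    rw [← mdifferentiableAt_iff_differentiableAt]
    exact MDifferentiableAt.comp (f := fun z : ℂ => φ (z, y.2)) y.1 h2 h1
  · filter_upwards [hφ.eventually_mem hq] with y hy
    simp [e.left_inv hy.2, hδ.eq_zero hΩ (hφ.mem hy.1)]
  · have h1 := hφ.immersion q hq
    intro v w hvw
    rw [← chartDeriv_mfderiv (hφq.mdifferentiableAt (by norm_num)) hp,
      ← chartDeriv_mfderiv (hφq.mdifferentiableAt (by norm_num)) hp] at hvw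
    exact h1 ((chartDeriv_bijective hp).1 hvw)
  · obtain ⟨v, hv⟩ := hδ.diff_ne_zero _ (hφ.mem hq)
    intro h0
    rw [diff_eq_fderiv hp hδp] at hv
    change fderiv ℝ (δ ∘ e.symm) (e (φ q)) = 0 at h0
    rw [h0] at hv
    exact hv rfl

theorem normalMetric_eq (hδ : IsBoundaryDistance E Ω δ)
    (hφ : IsFoliatedChart E (frontier Ω) V φ) (hq : q ∈ V) :
    ∀ᶠ y in 𝓝 q, normalMetric E δ φ y
      = |conormal (δ ∘ (chartAt E (φ q)).symm) (chartAt E (φ q) ∘ φ) y| := by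
  filter_upwards [hφ.eventually_mem hq] with y hy
  have hφy := (hφ.contMDiffOn.contMDiffAt (hφ.isOpen.mem_nhds hy.1)).mdifferentiableAt
    (by norm_num)
  rw [normalMetric, diff_eq_fderiv hy.2 (hδ.eventually_contMDiffAt (hφ.mem hy.1)).self_of_nhds,
    chartDeriv_smul hy.2, conormal, transVec, ← chartDeriv_mfderiv hφy hy.2]
  rfl

theorem leviForm_neg_rpow {p x : X} (hx : x ∈ (chartAt E p).source)
    (hδ : ContMDiffAt 𝓘(ℝ, E) 𝓘(ℝ, ℝ) 3 δ x) (hpos : 0 < δ x) (η : ℝ) (v : E) :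
    leviForm (fun y => -(δ y) ^ η) x v = η * δ x ^ (η - 2) *
      exponentForm (δ ∘ (chartAt E p).symm) (1 - η) (chartAt E p x) (chartDeriv p x v) := by
  have hc : ContDiffAt ℝ 2 (δ ∘ (chartAt E p).symm) (chartAt E p x) :=
    (contDiffAt_of_contMDiffAt hx hδ).of_le (by norm_num)
  have hx' : (δ ∘ (chartAt E p).symm) (chartAt E p x) = δ x := by
    simp [(chartAt E p).left_inv hx]
  have hpos' : 0 < (δ ∘ (chartAt E p).symm) (chartAt E p x) := hx' ▸ hpos
  rw [leviForm_eq_flatLevi hx, ← hx']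
  · exact flatLevi_neg_rpow hc hpos' η _
  · exact (hc.rpow_const_of_ne hpos'.ne').neg

theorem leviForm_neg_log {p x : X} (hx : x ∈ (chartAt E p).source)
    (hδ : ContMDiffAt 𝓘(ℝ, E) 𝓘(ℝ, ℝ) 3 δ x) (hpos : 0 < δ x) (v : E) :
    leviForm (fun y => -Real.log (δ y)) x v =
      exponentForm (δ ∘ (chartAt E p).symm) 1 (chartAt E p x) (chartDeriv p x v) / δ x ^ 2 := by
  have hc : ContDiffAt ℝ 2 (δ ∘ (chartAt E p).symm) (chartAt E p x) :=
    (contDiffAt_of_contMDiffAt hx hδ).of_le (by norm_num)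
  have hx' : (δ ∘ (chartAt E p).symm) (chartAt E p x) = δ x := by
    simp [(chartAt E p).left_inv hx]
  have hpos' : 0 < (δ ∘ (chartAt E p).symm) (chartAt E p x) := hx' ▸ hpos
  rw [leviForm_eq_flatLevi hx, ← hx']
  · exact flatLevi_neg_log hc hpos'.ne' _
  · exact (hc.log hpos'.ne').neg

theorem eventually_leviForm_pos (hE : Module.finrank ℂ E = 2) (hΩ : IsOpen Ω)
    (hδ : IsBoundaryDistance E Ω δ) (hφ : IsFoliatedChart E (frontier Ω) V φ) (hq : q ∈ V) {η : ℝ}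
    (hη : η ∈ Set.Ioo (0 : ℝ) 1)
    (hlt : gradientForm (δ ∘ (chartAt E (φ q)).symm) (chartAt E (φ q) ∘ φ) q
      < (1 - η) * (curvatureForm (δ ∘ (chartAt E (φ q)).symm) (chartAt E (φ q) ∘ φ) q
        + gradientForm (δ ∘ (chartAt E (φ q)).symm) (chartAt E (φ q) ∘ φ) q)) :
    ∀ᶠ x in 𝓝 (φ q), x ∈ Ω → ∀ v : E, v ≠ 0 → 0 < leviForm (fun y => -(δ y) ^ η) x v := by
  have h := isFlatChart hΩ hδ hφ hq
  have hp : φ q ∈ (chartAt E (φ q)).source := mem_chart_source E (φ q)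
  have h1 := h.eventually_exponentForm_pos hE
    (fun b a hba => h.chartModelForm_pos hE (sub_pos.2 hη.2) hlt hba)
  filter_upwards [((chartAt E (φ q)).continuousAt hp).eventually h1,
    (chartAt E (φ q)).open_source.mem_nhds hp, hδ.eventually_contMDiffAt (hφ.mem hq)]
    with x hx1 hx2 hx3 hxΩ v hv
  have hpos : 0 < δ x := (hδ.pos_iff x (subset_closure hxΩ)).1 hxΩ
  rw [leviForm_neg_rpow hx2 hx3 hpos]
  have h2 : chartDeriv (φ q) x v ≠ 0 := by
    intro h0
    exact hv ((chartDeriv_bijective hx2).1 (h0.trans (map_zero _).symm))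
  have h3 := hx1 (by simpa [(chartAt E (φ q)).left_inv hx2] using hpos.ne') _ h2
  have h4 := hη.1
  positivity

theorem eventually_collar (hE : Module.finrank ℂ E = 2) (hΩ : IsOpen Ω)
    (hδ : IsBoundaryDistance E Ω δ) (hφ : IsFoliatedChart E (frontier Ω) V φ) (hq : q ∈ V)
    {P : X → Prop} (hP : ∀ᶠ x in 𝓝 (φ q), P x) :
    ∀ᶠ y in 𝓝 (q, (0 : ℝ)), collar E φ q y ∈ (chartAt E (φ q)).source ∧
      chartAt E (φ q) (collar E φ q y) = thicken (chartAt E (φ q) ∘ φ) y ∧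
      ContMDiffAt 𝓘(ℝ, E) 𝓘(ℝ, ℝ) 3 δ (collar E φ q y) ∧ P (collar E φ q y) := by
  have h := isFlatChart hΩ hδ hφ hq
  have hp : φ q ∈ (chartAt E (φ q)).source := mem_chart_source E (φ q)
  have h1 : ∀ᶠ y in 𝓝 (q, (0 : ℝ)),
      thicken (chartAt E (φ q) ∘ φ) y ∈ (chartAt E (φ q)).target := by
    refine h.continuousAt_thicken.eventually ((chartAt E (φ q)).open_target.mem_nhds ?_)
    simp
  have h2 : ∀ᶠ y in 𝓝 (q, (0 : ℝ)),
      ContMDiffAt 𝓘(ℝ, E) 𝓘(ℝ, ℝ) 3 δ (collar E φ q y) ∧ P (collar E φ q y) := by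
    rw [← eventually_map (m := collar E φ q)
      (P := fun x => ContMDiffAt 𝓘(ℝ, E) 𝓘(ℝ, ℝ) 3 δ x ∧ P x), map_collar hE h]
    exact (hδ.eventually_contMDiffAt (hφ.mem hq)).and hP
  filter_upwards [h1, h2] with y hy1 hy2
  exact ⟨(chartAt E (φ q)).map_target hy1, (chartAt E (φ q)).right_inv hy1, hy2⟩

theorem frequently_collar (hE : Module.finrank ℂ E = 2) (hΩ : IsOpen Ω)
    (hδ : IsBoundaryDistance E Ω δ) (hφ : IsFoliatedChart E (frontier Ω) V φ) (hq : q ∈ V) :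
    ∃ᶠ y in 𝓝 (q, (0 : ℝ)), collar E φ q y ∈ Ω := by
  rw [← frequently_map (m := collar E φ q) (P := fun x => x ∈ Ω),
    map_collar hE (isFlatChart hΩ hδ hφ hq)]
  exact mem_closure_iff_frequently.1 (frontier_subset_closure (hφ.mem hq))

/-- Positivity is tested on the vectors T + s·a·N at points of Ω tending to the boundary, with a
optimal for c = 1 - η. In the limit the model form is nonnegative at its critical value. -/
theorem gradientForm_le (hE : Module.finrank ℂ E = 2) (hΩ : IsOpen Ω)
    (hδ : IsBoundaryDistance E Ω δ) (hφ : IsFoliatedChart E (frontier Ω) V φ) (hq : q ∈ V) {η : ℝ}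
    (hη : η ∈ Set.Ioo (0 : ℝ) 1)
    (hlev : ∀ᶠ x in 𝓝 (φ q), x ∈ Ω →
      ∀ v : E, v ≠ 0 → 0 < leviForm (fun y => -(δ y) ^ η) x v) :
    gradientForm (δ ∘ (chartAt E (φ q)).symm) (chartAt E (φ q) ∘ φ) q
      ≤ (1 - η) * (curvatureForm (δ ∘ (chartAt E (φ q)).symm) (chartAt E (φ q) ∘ φ) q
        + gradientForm (δ ∘ (chartAt E (φ q)).symm) (chartAt E (φ q) ∘ φ) q) := by
  have h := isFlatChart hΩ hδ hφ hq
  have hc : 0 < 1 - η := sub_pos.2 hη.2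
  obtain ⟨a, ha⟩ := h.exists_chartModelForm_eq hE hc
  rw [← sub_nonneg, ← ha]
  refine mul_nonneg hc.le ?_
  refine le_trans (by simp) (h.le_chartModelForm (1 - η) a (G := fun _ => 0) continuousAt_const ?_)
  refine ((frequently_collar hE hΩ hδ hφ hq).and_eventually
    (eventually_collar hE hΩ hδ hφ hq hlev)).mono ?_
  rintro y ⟨hyΩ, hys, hye, hyd, hylev⟩
  have hpos : 0 < δ (collar E φ q y) := (hδ.pos_iff _ (subset_closure hyΩ)).1 hyΩ
  refine ⟨hpos.ne', ?_⟩
  rw [mul_zero]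
  obtain ⟨v, hv⟩ := (chartDeriv_bijective hys).2
    (thickenLeaf (chartAt E (φ q) ∘ φ) y + y.2 • (a • transVec (chartAt E (φ q) ∘ φ) y.1))
  rw [← hv, ← hye]
  by_cases hv0 : v = 0
  · subst hv0
    simp [exponentForm, flatLevi, normSqPartial]
  · have h1 := hylev hyΩ v hv0
    rw [leviForm_neg_rpow hys hyd hpos] at h1
    have h2 : 0 < η * δ (collar E φ q y) ^ (η - 2) := by
      have := hη.1
      positivity
    exact (pos_of_mul_pos_right h1 h2.le).le

/-- For c = 1 the optimal a makes the model form equal to the curvature term. After division by s²,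
the bound δ²g(v, v) ≤ Q_1(v) tends to H²g(v₀, v₀), where v₀ is the nonzero leaf tangent. -/
theorem curvatureForm_pos (hE : Module.finrank ℂ E = 2) (hΩ : IsOpen Ω)
    (hδ : IsBoundaryDistance E Ω δ) (hφ : IsFoliatedChart E (frontier Ω) V φ) (hq : q ∈ V)
    [IsManifold 𝓘(ℝ, E) 1 X]
    (g : Bundle.ContinuousRiemannianMetric E (fun x : X => TangentSpace 𝓘(ℝ, E) x))
    (hg : ∀ᶠ x in 𝓝 (φ q), x ∈ Ω → ∀ v : E,
      g.inner x v v ≤ leviForm (fun y => -Real.log (δ y)) x v) :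
    0 < curvatureForm (δ ∘ (chartAt E (φ q)).symm) (chartAt E (φ q) ∘ φ) q := by
  have h := isFlatChart hΩ hδ hφ hq
  obtain ⟨a, ha⟩ := h.exists_chartModelForm_eq hE one_pos
  set ψ := chartAt E (φ q) ∘ φ with hψ
  have ha' : IsFlatChart.chartModelForm (δ ∘ (chartAt E (φ q)).symm) ψ q 1 1 a
      = curvatureForm (δ ∘ (chartAt E (φ q)).symm) ψ q := by linarith
  set w : (ℂ × ℝ) × ℝ → E := fun y => thickenLeaf ψ y + y.2 • (a • transVec ψ y.1) with hw
  -- The tangent vector at the collar point, in that point's own chart, whose coordinates in the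
  -- fixed chart are `w y`. Only the latter are known to vary continuously.
  set v : (ℂ × ℝ) × ℝ → E := fun y =>
    Function.invFun (chartDeriv (φ q) (collar E φ q y)) (w y) with hv
  have hev := eventually_collar hE hΩ hδ hφ hq hg
  have hvw : ∀ᶠ y in 𝓝 (q, (0 : ℝ)), chartDeriv (φ q) (collar E φ q y) (v y) = w y := by
    filter_upwards [hev] with y hy
    exact Function.invFun_eq ((chartDeriv_bijective hy.1).2 (w y))
  have hwc : ContinuousAt w (q, 0) :=
    (contDiffAt_thickenLeaf h.contDiffAt_param 0).continuousAt.add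
      (continuousAt_snd.smul (continuousAt_const.smul
        ((contDiffAt_transVec h.contDiffAt_param).continuousAt.comp
          (f := fun y : (ℂ × ℝ) × ℝ => y.1) (x := (q, 0)) continuousAt_fst)))
  have hcc : ContinuousAt (collar E φ q) (q, 0) := by
    have := (map_collar hE h).le
    rwa [← collar_apply_zero (E := E) (φ := φ) (q := q)] at this
  have hG := continuousAt_metric g collar_apply_zero hcc hwc hvw
  have hle := h.le_chartModelForm 1 a hG (by
    refine ((frequently_collar hE hΩ hδ hφ hq).and_eventually (hev.and hvw)).mono ?_
    rintro y ⟨hyΩ, ⟨hys, hye, hyd, hylev⟩, hyv⟩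
    have hpos : 0 < δ (collar E φ q y) := (hδ.pos_iff _ (subset_closure hyΩ)).1 hyΩ
    refine ⟨hpos.ne', ?_⟩
    have h1 := hylev hyΩ (v y)
    rw [leviForm_neg_log hys hyd hpos, hyv, hye, le_div_iff₀ (by positivity), mul_comm] at h1
    exact h1)
  rw [ha'] at hle
  refine lt_of_lt_of_le (mul_pos ?_ (g.pos _ _ ?_)) hle
  · have := h.conormal_ne_zero hE
    positivity
  · intro h0
    have h1 := hvw.self_of_nhds
    have h2 : v (q, 0) = 0 := h0
    have h3 : w (q, 0) = leafVec ψ q := by simp [hw]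
    rw [h2, map_zero, h3] at h1
    exact h.linearIndependent.ne_zero 0 h1.symm

end Boundary

/-! ### The local exponent and the sign of the curvature -/

section Exponent

variable {E : Type*} [NormedAddCommGroup E] [NormedSpace ℂ E]
  {X : Type*} [TopologicalSpace X] [ChartedSpace E X] [IsManifold 𝓘(ℂ, E) ω X]
  {Ω : Set X} {δ : X → ℝ} {V : Set (ℂ × ℝ)} {φ : ℂ × ℝ → X} {q : ℂ × ℝ}

/-- `eventually_leviForm_pos` admits every η in (0, 1) below the ratio and `gradientForm_le`
excludes every η above it; the ratio itself need not be decided. -/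
theorem localDFExponent_eq (hE : Module.finrank ℂ E = 2) (hΩ : IsOpen Ω)
    (hδ : IsBoundaryDistance E Ω δ) (hφ : IsFoliatedChart E (frontier Ω) V φ) (hq : q ∈ V)
    {θ A : ℝ} (hθ : θ = curvatureForm (δ ∘ (chartAt E (φ q)).symm) (chartAt E (φ q) ∘ φ) q)
    (hA : A = gradientForm (δ ∘ (chartAt E (φ q)).symm) (chartAt E (φ q) ∘ φ) q)
    (hpos : 0 < θ) : localDFExponent E Ω δ (φ q) = θ / (θ + A) := by
  have hA0 : 0 ≤ A := hA ▸ gradientForm_nonneg _ _ _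
  have hs : 0 < θ + A := by linarith
  have hmem : ∀ η ∈ Set.Ioo (0 : ℝ) 1, η < θ / (θ + A) → ∃ U : Set X, IsOpen U ∧ φ q ∈ U ∧
      StrictlyPSHOn (E := E) (fun x => -(δ x) ^ η) (U ∩ Ω) := by
    intro η hη hlt
    rw [lt_div_iff₀ hs] at hlt
    have h1 := eventually_leviForm_pos hE hΩ hδ hφ hq hη (by rw [← hθ, ← hA]; linarith)
    obtain ⟨U, hU, hUo, hqU⟩ := eventually_nhds_iff.1 h1
    exact ⟨U, hUo, hqU, fun x hx => hU x hx.1 hx.2⟩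
  have hratio : 0 < θ / (θ + A) := div_pos hpos hs
  have hratio' : θ / (θ + A) ≤ 1 := (div_le_one hs).2 (by linarith)
  refine csSup_eq_of_forall_le_of_forall_lt_exists_gt ?_ ?_ ?_
  · exact ⟨θ / (θ + A) / 2, ⟨by linarith, by linarith⟩,
      hmem _ ⟨by linarith, by linarith⟩ (by linarith)⟩
  · rintro η ⟨hη, U, hU, hqU, hpsh⟩
    have h1 := gradientForm_le hE hΩ hδ hφ hq hη (by
      filter_upwards [hU.mem_nhds hqU] with x hx hxΩ
      exact hpsh x ⟨hx, hxΩ⟩)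
    rw [← hθ, ← hA] at h1
    rw [le_div_iff₀ hs]
    linarith
  · intro r hr
    -- The maximum with 0 keeps η positive when r is negative.
    obtain ⟨η, hη1, hη2⟩ := exists_between (max_lt hr hratio)
    have hη : η ∈ Set.Ioo (0 : ℝ) 1 :=
      ⟨(le_max_right _ _).trans_lt hη1, hη2.trans_le hratio'⟩
    exact ⟨η, ⟨hη, hmem η hη hη2⟩, (le_max_left _ _).trans_lt hη1⟩

theorem eventually_notMem_of_isCompact [T2Space X] (hΩ : IsOpen Ω) {K : Set X} (hK : K ⊆ Ω)
    (hKc : IsCompact K) {p : X} (hp : p ∈ frontier Ω) : ∀ᶠ x in 𝓝 p, x ∉ K :=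
  hKc.isClosed.isOpen_compl.mem_nhds fun h => (hΩ.frontier_eq ▸ hp).2 (hK h)

/-- A positive exponent provides an admissible η, since the supremum of the empty set is 0, and the
compact exceptional set stays away from the boundary. Then `gradientForm_le` rearranges to (1 - η)Θ
≥ ηA ≥ 0, up to the common factor H². -/
theorem curvatureForm_nonneg [T2Space X] (hE : Module.finrank ℂ E = 2) (hΩ : IsOpen Ω)
    (hδ : IsBoundaryDistance E Ω δ) (hpos : 0 < dfExponent E Ω δ)
    (hφ : IsFoliatedChart E (frontier Ω) V φ) (hq : q ∈ V) :
    0 ≤ curvatureForm (δ ∘ (chartAt E (φ q)).symm) (chartAt E (φ q) ∘ φ) q := by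
  have hne : {η : ℝ | η ∈ Set.Ioo (0 : ℝ) 1 ∧ ∃ K ⊆ Ω, IsCompact K ∧
      StrictlyPSHOn (E := E) (fun x => -(δ x) ^ η) (Ω \ K)}.Nonempty := by
    by_contra h0
    rw [Set.not_nonempty_iff_eq_empty] at h0
    rw [dfExponent, h0, Real.sSup_empty] at hpos
    exact hpos.false
  obtain ⟨η, hη, K, hK, hKc, hpsh⟩ := hne
  have h1 := gradientForm_le hE hΩ hδ hφ hq hη (by
    filter_upwards [eventually_notMem_of_isCompact hΩ hK hKc (hφ.mem hq)] with x hx hxΩ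
    exact hpsh x ⟨hxΩ, hx⟩)
  have h2 := gradientForm_nonneg (δ ∘ (chartAt E (φ q)).symm) (chartAt E (φ q) ∘ φ) q
  have h3 : 0 ≤ (1 - η) * curvatureForm (δ ∘ (chartAt E (φ q)).symm) (chartAt E (φ q) ∘ φ) q := by
    nlinarith [mul_nonneg hη.1.le h2]
  exact nonneg_of_mul_nonneg_right h3 (sub_pos.2 hη.2)

theorem localDFExponent_formula (hE : Module.finrank ℂ E = 2) (hΩ : IsOpen Ω)
    (hδ : IsBoundaryDistance E Ω δ) (hφ : IsFoliatedChart E (frontier Ω) V φ) (hq : q ∈ V)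
    (hpos : 0 < curvatureForm (δ ∘ (chartAt E (φ q)).symm) (chartAt E (φ q) ∘ φ) q) :
    (localDFExponent E Ω δ (φ q) : ℂ) = (1 + formA (normalMetric E δ φ) q /
      chernCurvature (normalMetric E δ φ) q)⁻¹ := by
  have h := isFlatChart hΩ hδ hφ hq
  obtain ⟨h1, h2⟩ := h.curvature_eq hE (normalMetric_eq hδ hφ hq)
  rw [localDFExponent_eq hE hΩ hδ hφ hq rfl rfl hpos, h1, h2]
  have h3 := gradientForm_nonneg (δ ∘ (chartAt E (φ q)).symm) (chartAt E (φ q) ∘ φ) q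
  have h4 := h.conormal_ne_zero hE
  norm_cast
  generalize curvatureForm (δ ∘ (chartAt E (φ q)).symm) (chartAt E (φ q) ∘ φ) q = θ at *
  generalize gradientForm (δ ∘ (chartAt E (φ q)).symm) (chartAt E (φ q) ∘ φ) q = A at *
  have h5 : θ + A ≠ 0 := by positivity
  have h6 : 1 + A / θ ≠ 0 := by positivity
  field_simp

end Exponent

end LeviFlat

theorem corollary1p2
    {E : Type*} [NormedAddCommGroup E] [NormedSpace ℂ E] (hE : Module.finrank ℂ E = 2)
    {X : Type*} [TopologicalSpace X] [T2Space X] [ChartedSpace E X] [IsManifold 𝓘(ℂ, E) ω X]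
    (Ω : Set X) (hΩ_open : IsOpen Ω) (hΩ_conn : IsConnected Ω) (hΩ_comp : IsCompact (closure Ω))
    (hM : LeviFlat.HasLeviFlatBoundary E Ω)
    (δ : X → ℝ) (hδ : LeviFlat.IsBoundaryDistance E Ω δ)
    (hδ_pos : 0 < LeviFlat.dfExponent E Ω δ) :
    (∀ p ∈ frontier Ω, ∀ (V : Set (ℂ × ℝ)) (φ : ℂ × ℝ → X),
      LeviFlat.IsFoliatedChart E (frontier Ω) V φ → ∀ q ∈ V, φ q = p →
        0 ≤ LeviFlat.chernCurvature (LeviFlat.normalMetric E δ φ) q ∧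
        (LeviFlat.chernCurvature (LeviFlat.normalMetric E δ φ) q ≠ 0 →
          (LeviFlat.localDFExponent E Ω δ p : ℂ) =
            (1 + LeviFlat.formA (LeviFlat.normalMetric E δ φ) q /
              LeviFlat.chernCurvature (LeviFlat.normalMetric E δ φ) q)⁻¹)) ∧
    (LeviFlat.LogUniformlyPSH E Ω δ →
      ∀ p ∈ frontier Ω, ∀ (V : Set (ℂ × ℝ)) (φ : ℂ × ℝ → X),
        LeviFlat.IsFoliatedChart E (frontier Ω) V φ → ∀ q ∈ V, φ q = p →
          0 < LeviFlat.chernCurvature (LeviFlat.normalMetric E δ φ) q ∧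
          (LeviFlat.localDFExponent E Ω δ p : ℂ) =
            (1 + LeviFlat.formA (LeviFlat.normalMetric E δ φ) q /
              LeviFlat.chernCurvature (LeviFlat.normalMetric E δ φ) q)⁻¹) := by
  constructor
  · rintro p - V φ hφ q hq rfl
    have h := LeviFlat.isFlatChart hΩ_open hδ hφ hq
    have h1 := (h.curvature_eq hE (LeviFlat.normalMetric_eq hδ hφ hq)).1
    have h2 := LeviFlat.curvatureForm_nonneg hE hΩ_open hδ hδ_pos hφ hq
    refine ⟨?_, fun hne => LeviFlat.localDFExponent_formula hE hΩ_open hδ hφ hq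
      (lt_of_le_of_ne h2 fun h0 => hne ?_)⟩
    · rw [h1, Complex.zero_le_real]
      positivity
    · rw [h1, ← h0]
      simp
  · rintro ⟨g, -, K, hK, hKc, hg⟩ p - V φ hφ q hq rfl
    have h := LeviFlat.isFlatChart hΩ_open hδ hφ hq
    have h1 := (h.curvature_eq hE (LeviFlat.normalMetric_eq hδ hφ hq)).1
    have : IsManifold 𝓘(ℝ, E) 1 X := LeviFlat.isManifold_real
    have h2 := LeviFlat.curvatureForm_pos hE hΩ_open hδ hφ hq g (by
      filter_upwards [LeviFlat.eventually_notMem_of_isCompact hΩ_open hK hKc (hφ.mem hq)]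
        with x hx hxΩ
      exact hg x ⟨hxΩ, hx⟩)
    refine ⟨?_, LeviFlat.localDFExponent_formula hE hΩ_open hδ hφ hq h2⟩
    have h3 := h.conormal_ne_zero hE
    rw [h1, Complex.zero_lt_real]
    positivity
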